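/- Let $\mathbb{K}$ be a field of characteristic $0$ and $n\ge 1$. For $a,b\in\mathbb{Z}^n$ put $\langle a,b\rangle=\sum_i a_ib_i$, and let $e_1=(1,0,\ldots,0)\in\mathbb{Z}^n$. For a $\mathbb{Z}^n$-graded $\mathbb{K}$-vector space $W$, let $T(W)=\bigoplus_{p\ge1}W^{\otimes p}$, with the induced $\mathbb{Z}^n$-gradation and the coproduct $$\Delta(w_1\otimes\cdots\otimes w_p)=\sum_{I\sqcup J=\{1,\ldots,p-1\},\ I\neq\emptyset}\varepsilon(I;J)\;W_I\bigotimes\,(W_J\otimes w_p)\qquad(w_i\text{ homogeneous}),$$ where $W_I$ is the tensor product of the $w_i$, $i\in I$, in increasing order of the indices (similarly $W_J$), and $\varepsilon(I;J)=\prod_{i\in I,\,j\in J,\,j<i}(-1)^{\langle \deg w_i,\deg w_j\rangle}$ is the Koszul sign. A cohomomorphism $\mathcal F:T(W)\to T(W')$ is a linear map of weight $0$ with $\Delta\mathcal F=(\mathcal F\otimes\mathcal F)\Delta$. A coderivation of weight $q\in\mathbb{Z}^n$ is a linear map $Q:T(W)\to T(W)$ of weight $q$ with $\Delta Q=(Q\otimes\mathrm{id}+\mathrm{id}\otimes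 Q)\Delta$, where $(\mathrm{id}\otimes Q)(x\otimes y)=(-1)^{\langle q,\deg x\rangle}x\otimes Qy$. Let $V,V'$ be $\mathbb{Z}^n$-graded $\mathbb{K}$-vector spaces. Let $\downarrow V$ be the space $V$ with the gradation $(\downarrow V)^{a}=V^{a+e_1}$, let $\downarrow:V\to\downarrow V$ be the identity map and $\uparrow$ its inverse, and let $\downarrow^{\otimes p}(v_1\otimes\cdots\otimes v_p)=(-1)^{\sum_{s=1}^p\langle(p-s)e_1,\deg v_s\rangle}\downarrow v_1\otimes\cdots\otimes\downarrow v_p$. To a cohomomorphism $\mathcal F:T(\downarrow V)\to T(\downarrow V')$ corresponds the sequence $f=(f_1,f_2,\ldots)$ of multilinear maps $f_p=\uparrow\circ\,\mathcal F_p\,\circ\downarrow^{\otimes p}:V^{\times p}\to V'$ of weight $(1-p)e_1$, where $\mathcal F_p:(\downarrow V)^{\otimes p}\to\downarrow V'$ is the restriction of $\mathcal F$ to $(\downarrow V)^{\otimes p}$ followed by the projection $T(\downarrow V')\to\downarrow V'$. A $\mathrm{Lod}_\infty$ structure on $V$ is a coderivation $Q$ of $T(\downarrow V)$ of weight $e_1$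 with $Q^2=0$. A $\mathrm{Lod}_\infty$ morphism $(V,Q)\to(V',Q')$ is a cohomomorphism $\mathcal F:T(\downarrow V)\to T(\downarrow V')$ with $Q'\mathcal F=\mathcal FQ$; it is a $\mathrm{Lod}_\infty$ isomorphism if $f_1:V\to V'$ is bijective. Then the following hold. 1. Every cohomomorphism $\mathcal F:T(\downarrow V)\to T(\downarrow V')$ whose first map $f_1:V\to V'$ is bijective is invertible: there is a cohomomorphism $\mathcal F^{-1}:T(\downarrow V')\to T(\downarrow V)$ with $\mathcal F\mathcal F^{-1}=\mathrm{id}$ and $\mathcal F^{-1}\mathcal F=\mathrm{id}$. 2. Let $Q$ be a $\mathrm{Lod}_\infty$ structure on $V$, and let $f=(f_1,f_2,\ldots)$ be any sequence of multilinear maps $f_p:V^{\times p}\to V$ of weight $(1-p)e_1$ with $f_1=\mathrm{id}_V$. Then there is exactly one cohomomorphism $\mathcal F:T(\downarrow V)\to T(\downarrow V)$ whose corresponding sequence is $f$; it has an inverse cohomomorphism $\mathcal F^{-1}$, the map $\mathcal FQ\mathcal F^{-1}$ is a $\mathrm{Lod}_\infty$ structure on $V$, and $\mathcal F$ is a $\mathrm{Lod}_\infty$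 isomorphism from $(V,Q)$ to $(V,\mathcal FQ\mathcal F^{-1})$. 3. Every $\mathrm{Lod}_\infty$ isomorphism $\mathcal F:(V,Q)\to(V',Q')$ has an inverse cohomomorphism $\mathcal F^{-1}$, and $\mathcal F^{-1}:(V',Q')\to(V,Q)$ is a $\mathrm{Lod}_\infty$ isomorphism as well. -/

import Mathlib

open scoped TensorProduct DirectSum

noncomputable section

namespace LodayInfinity

/-- The group of degrees `ℤⁿ`. -/
abbrev Deg (n : ℕ) : Type := Fin n → ℤ

/-- The pairing `⟨a, b⟩ = ∑ᵢ aᵢ bᵢ` of two degrees. -/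
def pairing {n : ℕ} (a b : Deg n) : ℤ := ∑ i, a i * b i

/-- The degree `e₁ = (1, 0, …, 0)`. -/
def e1 (n : ℕ) [NeZero n] : Deg n := Pi.single 0 1

section GradedSpaces

variable {K : Type*} [Field K] {n : ℕ} {W : Type*} [AddCommGroup W] [Module K W]

/-- The operator `v ↦ (-1)^⟨d, deg v⟩ v` on a graded vector space. -/
def signOp (𝒲 : Deg n → Submodule K W) [DirectSum.Decomposition 𝒲] (d : Deg n) : W →ₗ[K] W :=
  (DirectSum.toModule K (Deg n) W fun a => (-1 : K) ^ pairing d a • (𝒲 a).subtype) ∘ₗ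
    (DirectSum.decomposeLinearEquiv 𝒲).toLinearMap

theorem signOp_apply (𝒲 : Deg n → Submodule K W) [DirectSum.Decomposition 𝒲] (d a : Deg n)
    {v : W} (hv : v ∈ 𝒲 a) : signOp 𝒲 d v = (-1 : K) ^ pairing d a • v := by
  have h := DirectSum.decomposeLinearEquiv_apply_coe 𝒲 a ⟨v, hv⟩
  simp only at h
  simp [signOp, h]

/-- The desuspension `↓V`: the same space, with the gradation `(↓V)^a = V^(a + e₁)`. -/
def desusp [NeZero n] (𝒱 : Deg n → Submodule K W) : Deg n → Submodule K W :=
  fun a => 𝒱 (a + e1 n)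

instance [NeZero n] (𝒱 : Deg n → Submodule K W) [DirectSum.Decomposition 𝒱] :
    DirectSum.Decomposition (desusp 𝒱) :=
  DirectSum.IsInternal.chooseDecomposition _ (by
    have h := DirectSum.Decomposition.isInternal 𝒱
    rw [DirectSum.isInternal_submodule_iff_iSupIndep_and_iSup_eq_top] at h ⊢
    refine ⟨h.1.comp (add_left_injective (e1 n)), ?_⟩
    rw [← h.2]
    exact (Equiv.addRight (e1 n)).iSup_comp (g := 𝒱))

/-- The multilinear map on a graded vector space which coincides with `φ a` on the tuples of
homogeneous vectors of degrees `a = (a₁, …, a_p)`. -/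
def ofHomogeneous {M : Type*} [AddCommMonoid M] [Module K M]
    (𝒲 : Deg n → Submodule K W) [DirectSum.Decomposition 𝒲] {p : ℕ}
    (φ : (Fin p → Deg n) → MultilinearMap K (fun _ : Fin p => W) M) :
    MultilinearMap K (fun _ : Fin p => W) M :=
  (MultilinearMap.fromDirectSumEquiv (R := K) (M := fun (_ : Fin p) (a : Deg n) => 𝒲 a)
      fun a => (φ a).compLinearMap fun i => (𝒲 (a i)).subtype).compLinearMap
    fun _ => (DirectSum.decomposeLinearEquiv 𝒲).toLinearMap

theorem ofHomogeneous_apply {M : Type*} [AddCommMonoid M] [Module K M]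
    (𝒲 : Deg n → Submodule K W) [DirectSum.Decomposition 𝒲] {p : ℕ}
    (φ : (Fin p → Deg n) → MultilinearMap K (fun _ : Fin p => W) M)
    (a : Fin p → Deg n) (v : Fin p → W) (hv : ∀ i, v i ∈ 𝒲 (a i)) :
    ofHomogeneous 𝒲 φ v = φ a v := by
  have h : (fun i => DirectSum.decomposeLinearEquiv 𝒲 (v i)) =
      fun i => DirectSum.lof K (Deg n) (fun b => 𝒲 b) (a i) ⟨v i, hv i⟩ :=
    funext fun i => DirectSum.decomposeLinearEquiv_apply_coe 𝒲 (a i) ⟨v i, hv i⟩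
  simp only [ofHomogeneous, MultilinearMap.compLinearMap_apply, LinearEquiv.coe_coe]
  rw [h]
  exact MultilinearMap.fromDirectSumEquiv_lof (M := fun (_ : Fin p) (a : Deg n) => 𝒲 a) _ a
    fun i => ⟨v i, hv i⟩

end GradedSpaces

section TensorCoalgebra

variable (K : Type*) [Field K] {n : ℕ} (W : Type*) [AddCommGroup W] [Module K W]

/-- The reduced tensor space `T(W) = ⨁_{p ≥ 1} W^{⊗p}`; the summand of index `m` is
`W^{⊗(m+1)}`. -/
abbrev RedTensor : Type _ := ⨁ m : ℕ, ⨂[K]^(m + 1) W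

/-- The map `W^{⊗p} → T(W)`: the inclusion for `p ≥ 1`, and zero for `p = 0`. -/
def incl : (p : ℕ) → (⨂[K]^p W) →ₗ[K] RedTensor K W
  | 0 => 0
  | m + 1 => DirectSum.lof K ℕ (fun m => ⨂[K]^(m + 1) W) m

/-- The projection `pr : T(W) → W`. -/
def pr : RedTensor K W →ₗ[K] W :=
  (PiTensorProduct.subsingletonEquiv (R := K) (s := fun _ : Fin 1 => W) 0).toLinearMap ∘ₗ
    DirectSum.component K ℕ (fun m => ⨂[K]^(m + 1) W) 0

/-- The word `v₁ ⊗ ⋯ ⊗ v_p ∈ T(W)` as a multilinear map (zero for `p = 0`). -/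
def word (p : ℕ) : MultilinearMap K (fun _ : Fin p => W) (RedTensor K W) :=
  (incl K W p).compMultilinearMap (PiTensorProduct.tprod K)

theorem pr_word_one (v : Fin 1 → W) : pr K W (word K W 1 v) = v 0 := by
  have h : DirectSum.component K ℕ (fun m => ⨂[K]^(m + 1) W) 0 (word K W 1 v) =
      PiTensorProduct.tprod K v :=
    DirectSum.component.lof_self (R := K) (ι := ℕ) (M := fun m => ⨂[K]^(m + 1) W) 0 _
  rw [pr, LinearMap.comp_apply, h]
  exact PiTensorProduct.subsingletonEquiv_apply_tprod 0 v

theorem pr_word_add_two (m : ℕ) (v : Fin (m + 2) → W) : pr K W (word K W (m + 2) v) = 0 := by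
  simp [pr, word, incl, DirectSum.component.of]

/-- `(v₁, …, v_p) ↦ V_I ⊗ V_J`, where `J` is the complement of `I`, and where `V_I`, `V_J` are
the words made of the `v_i` with `i ∈ I`, respectively `i ∈ J`, in natural order. -/
def splitWord (p : ℕ) (I : Finset (Fin p)) :
    MultilinearMap K (fun _ : Fin p => W) (RedTensor K W ⊗[K] RedTensor K W) :=
  ((word K W I.card).domCoprod (word K W Iᶜ.card)).domDomCongr
    (finSumEquivOfFinset rfl rfl)

variable {K W}

theorem splitWord_apply (p : ℕ) (I : Finset (Fin p)) (v : Fin p → W) :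
    splitWord K W p I v =
      word K W I.card (fun i => v (I.orderEmbOfFin rfl i)) ⊗ₜ[K]
        word K W Iᶜ.card (fun j => v (Iᶜ.orderEmbOfFin rfl j)) := rfl

variable (K) in
/-- The Koszul sign of `V_(I;J) → V_(I ∪ J)`, where `J` is the complement of `I`, and where the
`i`-th vector has degree `a i`: each pair `j < i` with `i ∈ I`, `j ∈ J` contributes
`(-1)^⟨aᵢ, aⱼ⟩`. -/
def koszulSign {p : ℕ} (a : Fin p → Deg n) (I : Finset (Fin p)) : K :=
  ∏ i ∈ I, ∏ j ∈ Iᶜ with j < i, (-1 : K) ^ pairing (a i) (a j)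

variable (𝒲 : Deg n → Submodule K W)

/-- The `ℤⁿ`-gradation of `T(W)`: `T(W)^d` is spanned by the words of homogeneous vectors whose
degrees add up to `d`. -/
def tensorGrading (d : Deg n) : Submodule K (RedTensor K W) :=
  Submodule.span K {x | ∃ (p : ℕ) (a : Fin p → Deg n) (v : Fin p → W),
    (∀ i, v i ∈ 𝒲 (a i)) ∧ ∑ i, a i = d ∧ x = word K W p v}

variable [DirectSum.Decomposition 𝒲]

/-- The coproduct of `T(W)`: for homogeneous `v_i`,
`Δ(v₁ ⊗ ⋯ ⊗ v_p) = ∑ ε(I;J) V_I ⊗ (V_J ⊗ v_p)`, the sum being over all `I ∪ J = {1, …, p-1}`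
with `I ≠ ∅`. In the code, the complement of `I` is taken in `{1, …, p}`; it is `J ∪ {p}`, and
`p`, being its largest element, does not change the Koszul sign. -/
def coproduct : RedTensor K W →ₗ[K] RedTensor K W ⊗[K] RedTensor K W :=
  DirectSum.toModule K ℕ _ fun m => PiTensorProduct.lift <| ofHomogeneous 𝒲 fun a =>
    ∑ I : Finset (Fin (m + 1)) with I.Nonempty ∧ Fin.last m ∉ I,
      koszulSign K a I • splitWord K W (m + 1) I

theorem coproduct_word (m : ℕ) (a : Fin (m + 1) → Deg n) (v : Fin (m + 1) → W)
    (hv : ∀ i, v i ∈ 𝒲 (a i)) :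
    coproduct 𝒲 (word K W (m + 1) v) =
      ∑ I : Finset (Fin (m + 1)) with I.Nonempty ∧ Fin.last m ∉ I,
        koszulSign K a I • splitWord K W (m + 1) I v := by
  simp only [coproduct, word, incl, LinearMap.compMultilinearMap_apply,
    DirectSum.toModule_lof, PiTensorProduct.lift.tprod]
  rw [ofHomogeneous_apply 𝒲 _ a v hv]
  simp

/-- The operator `x ↦ (-1)^⟨d, deg x⟩ x` on `T(W)`. -/
def tensorSignOp (d : Deg n) : RedTensor K W →ₗ[K] RedTensor K W :=
  DirectSum.toModule K ℕ _ fun m =>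
    incl K W (m + 1) ∘ₗ PiTensorProduct.map fun _ => signOp 𝒲 d

theorem pairing_sum {p : ℕ} (d : Deg n) (a : Fin p → Deg n) :
    pairing d (∑ i, a i) = ∑ i, pairing d (a i) := by
  simp only [pairing, Finset.sum_apply, Finset.mul_sum]
  exact Finset.sum_comm

theorem tensorSignOp_apply (d c : Deg n) {x : RedTensor K W} (hx : x ∈ tensorGrading 𝒲 c) :
    tensorSignOp 𝒲 d x = (-1 : K) ^ pairing d c • x := by
  induction hx using Submodule.span_induction with
  | zero => simp
  | add x y _ _ hx hy => rw [map_add, hx, hy, smul_add]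
  | smul r x _ hx => rw [map_smul, hx, smul_comm]
  | mem x hx =>
    obtain ⟨p, a, v, hv, rfl, rfl⟩ := hx
    have hprod : ∀ (q : ℕ) (z : Fin q → ℤ), (-1 : K) ^ (∑ i, z i) = ∏ i, (-1 : K) ^ z i := by
      intro q z
      induction q with
      | zero => simp
      | succ q ih => rw [Fin.sum_univ_succ, Fin.prod_univ_succ, zpow_add₀ (by simp), ih]
    cases p with
    | zero => simp [word, incl]
    | succ m =>
      simp only [tensorSignOp, word, incl, LinearMap.compMultilinearMap_apply,
        DirectSum.toModule_lof, LinearMap.comp_apply, PiTensorProduct.map_tprod]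
      rw [← map_smul, pairing_sum, hprod, ← MultilinearMap.map_smul_univ]
      congr 2
      funext i
      exact signOp_apply 𝒲 d (a i) (hv i)

end TensorCoalgebra

section Maps

variable {K : Type*} [Field K] {n : ℕ}
  {W : Type*} [AddCommGroup W] [Module K W] {W' : Type*} [AddCommGroup W'] [Module K W']

/-- A cohomomorphism of tensor coalgebras `(T(W), Δ) → (T(W'), Δ)`: a linear map `F` of weight
`0` such that `Δ F = (F ⊗ F) Δ`. -/
@[ext]
structure Cohom (𝒲 : Deg n → Submodule K W) [DirectSum.Decomposition 𝒲]
    (𝒲' : Deg n → Submodule K W') [DirectSum.Decomposition 𝒲'] where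
  toLin : RedTensor K W →ₗ[K] RedTensor K W'
  weight : ∀ d, ∀ x ∈ tensorGrading 𝒲 d, toLin x ∈ tensorGrading 𝒲' d
  comul : coproduct 𝒲' ∘ₗ toLin = TensorProduct.map toLin toLin ∘ₗ coproduct 𝒲

/-- A coderivation of weight `q` of `(T(W), Δ)`: a linear map `Q` of weight `q` such that
`Δ Q = (Q ⊗ id + id ⊗ Q) Δ`, where `(id ⊗ Q)(x ⊗ y) = (-1)^⟨q, deg x⟩ x ⊗ Q y`. -/
structure IsCoderivation (𝒲 : Deg n → Submodule K W) [DirectSum.Decomposition 𝒲] (q : Deg n)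
    (Q : RedTensor K W →ₗ[K] RedTensor K W) : Prop where
  weight : ∀ d, ∀ x ∈ tensorGrading 𝒲 d, Q x ∈ tensorGrading 𝒲 (d + q)
  comul : coproduct 𝒲 ∘ₗ Q =
    (TensorProduct.map Q LinearMap.id + TensorProduct.map (tensorSignOp 𝒲 q) Q) ∘ₗ coproduct 𝒲

end Maps

section LodInfinity

variable {K : Type*} [Field K] {n : ℕ} [NeZero n]
  {V : Type*} [AddCommGroup V] [Module K V] {V' : Type*} [AddCommGroup V'] [Module K V']

/-- The map `↓^{⊗p} : V^{×p} → T(↓V)`, which sends homogeneous `(v₁, …, v_p)` to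
`(-1)^(∑ₛ ⟨(p-s)e₁, vₛ⟩) ↓v₁ ⊗ ⋯ ⊗ ↓v_p`. -/
def desuspWord (𝒱 : Deg n → Submodule K V) [DirectSum.Decomposition 𝒱] (p : ℕ) :
    MultilinearMap K (fun _ : Fin p => V) (RedTensor K V) :=
  (word K V p).compLinearMap fun s => signOp 𝒱 ((p - (s + 1) : ℤ) • e1 n)

/-- The sequence of multilinear maps corresponding to a linear map `Φ : T(↓V) → T(↓V')`: the
`p`-th one is `↑ ∘ Φ_p ∘ ↓^{⊗p} : V^{×p} → V'`, where `Φ_p : T^p(↓V) → ↓V'` is the `p`-th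
corestriction of `Φ`. The maps are numbered from `0`: the entry `m` is the map with
`p = m + 1`. -/
def seqOf (𝒱 : Deg n → Submodule K V) [DirectSum.Decomposition 𝒱]
    (Φ : RedTensor K V →ₗ[K] RedTensor K V') (m : ℕ) :
    MultilinearMap K (fun _ : Fin (m + 1) => V) V' :=
  (pr K V' ∘ₗ Φ).compMultilinearMap (desuspWord 𝒱 (m + 1))

/-- The `p`-th multilinear map of the sequence has weight `(1 - p) e₁`, for all `p ≥ 1` (with
`p = m + 1`). -/
def HasCohomWeights (𝒱 : Deg n → Submodule K V) (𝒱' : Deg n → Submodule K V')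
    (f : (m : ℕ) → MultilinearMap K (fun _ : Fin (m + 1) => V) V') : Prop :=
  ∀ (m : ℕ) (a : Fin (m + 1) → Deg n) (v : Fin (m + 1) → V), (∀ i, v i ∈ 𝒱 (a i)) →
    f m v ∈ 𝒱' ((∑ i, a i) + (1 - (m + 1 : ℤ)) • e1 n)

/-- The linear map underlying a unary multilinear map. -/
def unary (g : MultilinearMap K (fun _ : Fin (0 + 1) => V) V') : V → V' := fun v => g fun _ => v

/-- A `Lod_∞` structure on the graded vector space `V`: a codifferential of weight `e₁` of the
tensor coalgebra `(T(↓V), Δ)`. -/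
@[ext]
structure LodInfty (𝒱 : Deg n → Submodule K V) [DirectSum.Decomposition 𝒱] where
  Q : RedTensor K V →ₗ[K] RedTensor K V
  isCoderivation : IsCoderivation (desusp 𝒱) (e1 n) Q
  sq_zero : Q ∘ₗ Q = 0

/-- A cohomomorphism `F : (T(↓V), Δ) → (T(↓V'), Δ)` is a `Lod_∞` morphism `(V, π) → (V', π')` if
it intertwines the codifferentials. -/
def IsLodMorphism {𝒱 : Deg n → Submodule K V} [DirectSum.Decomposition 𝒱]
    {𝒱' : Deg n → Submodule K V'} [DirectSum.Decomposition 𝒱']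
    (π : LodInfty 𝒱) (π' : LodInfty 𝒱') (F : Cohom (desusp 𝒱) (desusp 𝒱')) : Prop :=
  π'.Q ∘ₗ F.toLin = F.toLin ∘ₗ π.Q

/-- A `Lod_∞` isomorphism is a `Lod_∞` morphism whose first map `f₁ : V → V'` is bijective. -/
def IsLodIsomorphism {𝒱 : Deg n → Submodule K V} [DirectSum.Decomposition 𝒱]
    {𝒱' : Deg n → Submodule K V'} [DirectSum.Decomposition 𝒱']
    (π : LodInfty 𝒱) (π' : LodInfty 𝒱') (F : Cohom (desusp 𝒱) (desusp 𝒱')) : Prop :=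
  IsLodMorphism π π' F ∧ Function.Bijective (unary (seqOf 𝒱 F.toLin 0))

/-- Two cohomomorphisms are inverse to each other: both composites are the identity. -/
def AreInverse {𝒲 : Deg n → Submodule K V} [DirectSum.Decomposition 𝒲]
    {𝒲' : Deg n → Submodule K V'} [DirectSum.Decomposition 𝒲']
    (F : Cohom 𝒲 𝒲') (G : Cohom 𝒲' 𝒲) : Prop :=
  F.toLin ∘ₗ G.toLin = LinearMap.id ∧ G.toLin ∘ₗ F.toLin = LinearMap.id

/-- The identity of `T(↓V)` corresponds to the sequence `(id, 0, 0, …)`. -/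
theorem seqOf_id (𝒱 : Deg n → Submodule K V) [DirectSum.Decomposition 𝒱] :
    unary (seqOf 𝒱 (LinearMap.id : RedTensor K V →ₗ[K] RedTensor K V) 0) = id ∧
      ∀ m, seqOf 𝒱 (LinearMap.id : RedTensor K V →ₗ[K] RedTensor K V) (m + 1) = 0 := by
  have h0 : signOp 𝒱 (0 : Deg n) = LinearMap.id := by
    refine DirectSum.decompose_lhom_ext 𝒱 fun a => LinearMap.ext fun v => ?_
    simp [signOp_apply 𝒱 0 a v.2, pairing]
  constructor
  · funext v
    refine (pr_word_one K V _).trans ?_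
    simp [h0]
  · intro m
    ext v
    exact pr_word_add_two (K := K) (W := V) m fun i =>
      signOp 𝒱 ((((m + 1 + 1 : ℕ) : ℤ) - ((i : ℕ) + 1)) • e1 n) (v i)

end LodInfinity

end LodayInfinity

end

/-! The coproduct `Δ` is one half of the unshuffle coproduct of the full tensor algebra. Write `∑ x₁
⊗ x₂` for the unshuffle of `x`; it is coassociative, counital and graded cocommutative. Then `Δ(xw)
= ∑ x̄₁ ⊗ x₂w` for a last letter `w`, the bar removing the constant term (`coproduct_ofAlg_mul_ι`).
All signs are thereby generated by one rule: a letter passing a word.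

A cohomomorphism `F` with corestriction `φ`, extended by `F(1) = 1`, must satisfy `F(xw) = ∑ F(x₁)
φ(x₂w)` (`Cohom.extend_eq`), so it is determined by `φ`. Conversely this recursion has a solution
`cohomLift`, and `unshuffle_comp_cohomLift` shows that it respects the unshuffle, hence `Δ`; here
cocommutativity is indispensable. Since `F(xw)` involves `F` on all subwords `x₁` of `x`, the
recursion is not one on the last letter. The map `x ↦ ∑ F(x₁) ⊗ x₂` (`liftAux`) does have a
last-letter recursion, and the counit recovers `F` from it.

For invertibility, filter by word length. The only term of the recursion of full length is `F(x)
φ(w)`, so modulo shorter words `F` is the algebra morphism induced by its linear part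
(`cohomLift_sub_algMap_mem`). If the linear part is bijective, `F` composed with the inverse algebra
morphism is the identity plus a map lowering length, hence bijective. The inverse is homogeneous,
and it is formally a cohomomorphism.

The remaining claims follow. Sequences `f` and corestrictions correspond to each other through signs
(`seqOf_eq_iff`), conjugation preserves coderivations (`IsCoderivation.conj`), and the linear part
of an inverse is the inverse of the linear part. -/

open scoped TensorProduct DirectSum

noncomputable section

namespace LodayInfinity

open TensorAlgebra (ι)

/-! ### Last-letter recursion, gradation and sign operators on the tensor algebra -/

section Recursion

variable {K : Type*} [Field K] {n : ℕ} {W : Type*} [AddCommGroup W] [Module K W]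
  {M : Type*} [AddCommMonoid M] [Module K M]

/-- The linear map `T(W) → M` defined by recursion on the last letter. -/
def recMap (A : W →ₗ[K] Module.End K M) (m : M) : TensorAlgebra K W →ₗ[K] M :=
  -- The lift takes values in the opposite of `Module.End`, so that the last letter of a word acts
  -- last.
  LinearMap.applyₗ m ∘ₗ (MulOpposite.opLinearEquiv K).symm.toLinearMap ∘ₗ
    (TensorAlgebra.lift K ((MulOpposite.opLinearEquiv K).toLinearMap ∘ₗ A)).toLinearMap

@[simp]
theorem recMap_one (A : W →ₗ[K] Module.End K M) (m : M) : recMap A m 1 = m := by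
  simp [recMap]

@[simp]
theorem recMap_mul_ι (A : W →ₗ[K] Module.End K M) (m : M) (x : TensorAlgebra K W) (w : W) :
    recMap A m (x * ι K w) = A w (recMap A m x) := by
  simp [recMap]

/-- Right multiplication by a letter. -/
def rmul (w : W) : TensorAlgebra K W →ₗ[K] TensorAlgebra K W :=
  LinearMap.mulRight K (ι K w)

@[simp]
theorem rmul_apply (w : W) (x : TensorAlgebra K W) : rmul w x = x * ι K w := rfl

variable (𝒲 : Deg n → Submodule K W)

/-- The homogeneous monomials of the tensor algebra. -/
inductive HomMonomial : Deg n → TensorAlgebra K W → Prop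
  | one : HomMonomial 0 1
  | mul {d a : Deg n} {x : TensorAlgebra K W} {w : W} (hx : HomMonomial d x) (hw : w ∈ 𝒲 a) :
      HomMonomial (d + a) (x * ι K w)

/-- The `ℤⁿ`-gradation of the tensor algebra. -/
def algGrading (d : Deg n) : Submodule K (TensorAlgebra K W) :=
  Submodule.span K {x | HomMonomial 𝒲 d x}

variable {𝒲}

theorem one_mem_algGrading : (1 : TensorAlgebra K W) ∈ algGrading 𝒲 0 :=
  Submodule.subset_span .one

theorem mul_ι_mem_algGrading {d a : Deg n} {x : TensorAlgebra K W} {w : W}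
    (hx : x ∈ algGrading 𝒲 d) (hw : w ∈ 𝒲 a) : x * ι K w ∈ algGrading 𝒲 (d + a) := by
  have h : algGrading 𝒲 d ≤ (algGrading 𝒲 (d + a)).comap (rmul w) :=
    Submodule.span_le.2 fun y hy => Submodule.subset_span (.mul hy hw)
  exact h hx

variable [DirectSum.Decomposition 𝒲]

variable (𝒲) in
theorem span_homogeneous : Submodule.span K {w | ∃ a, w ∈ 𝒲 a} = ⊤ := by
  rw [eq_top_iff, ← (DirectSum.Decomposition.isInternal 𝒲).submodule_iSup_eq_top]
  exact iSup_le fun a w hw => Submodule.subset_span ⟨a, hw⟩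

variable (𝒲) in
/-- Induction on the last letter. -/
theorem right_induction (P : Submodule K (TensorAlgebra K W)) (h1 : 1 ∈ P)
    (hmul : ∀ x ∈ P, ∀ a, ∀ w ∈ 𝒲 a, x * ι K w ∈ P) : P = ⊤ := by
  have hmul' : ∀ x ∈ P, ∀ w, x * ι K w ∈ P := by
    intro x hx w
    have hw : w ∈ Submodule.span K {w | ∃ a, w ∈ 𝒲 a} := by
      rw [span_homogeneous]; trivial
    induction hw using Submodule.span_induction with
    | mem w hw => exact hw.elim fun a hw => hmul x hx a w hw
    | zero => simp
    | add u v _ _ hu hv => rw [map_add, mul_add]; exact P.add_mem hu hv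
    | smul c u _ hu => rw [map_smul, mul_smul_comm]; exact P.smul_mem c hu
  -- The induction principle of the tensor algebra is not one-sided; quantifying over the left
  -- factor turns the product case into two successive right multiplications.
  have key : ∀ y : TensorAlgebra K W, ∀ x ∈ P, x * y ∈ P := by
    intro y
    induction y using TensorAlgebra.induction with
    | algebraMap r =>
      intro x hx
      rw [← Algebra.commutes, ← Algebra.smul_def]
      exact P.smul_mem r hx
    | ι w => exact fun x hx => hmul' x hx w
    | mul a b ha hb => intro x hx; rw [← mul_assoc]; exact hb _ (ha x hx)
    | add a b ha hb => intro x hx; rw [mul_add]; exact P.add_mem (ha x hx) (hb x hx)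
  rw [eq_top_iff]
  intro y _
  simpa using key y 1 h1

variable (𝒲) in
theorem linearMap_ext {f g : TensorAlgebra K W →ₗ[K] M} (h1 : f 1 = g 1)
    (hmul : ∀ x a, ∀ w ∈ 𝒲 a, f x = g x → f (x * ι K w) = g (x * ι K w)) : f = g := by
  rw [← LinearMap.eqLocus_eq_top]
  exact right_induction 𝒲 _ h1 fun x hx a w hw => hmul x a w hw hx

variable (𝒲) in
theorem span_algGrading : Submodule.span K {x | ∃ d, x ∈ algGrading 𝒲 d} = ⊤ := by
  refine right_induction 𝒲 _ (Submodule.subset_span ⟨0, one_mem_algGrading⟩) fun x hx a w hw => ?_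
  have h : Submodule.span K {x | ∃ d, x ∈ algGrading 𝒲 d} ≤
      (Submodule.span K {x | ∃ d, x ∈ algGrading 𝒲 d}).comap (rmul w) :=
    Submodule.span_le.2 fun y ⟨d, hy⟩ => Submodule.subset_span ⟨d + a, mul_ι_mem_algGrading hy hw⟩
  exact h hx

variable (𝒲) in
theorem linearMap_ext_homogeneous {f g : TensorAlgebra K W →ₗ[K] M}
    (h : ∀ d, ∀ x ∈ algGrading 𝒲 d, f x = g x) : f = g := by
  rw [← LinearMap.eqLocus_eq_top, eq_top_iff, ← span_algGrading 𝒲]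
  exact Submodule.span_le.2 fun x ⟨d, hx⟩ => h d x hx

variable (𝒲) in
/-- The linear map on a graded vector space given by `B a` in degree `a`. -/
def ofDegree (B : Deg n → W →ₗ[K] M) : W →ₗ[K] M :=
  (DirectSum.toModule K (Deg n) M fun a => B a ∘ₗ (𝒲 a).subtype) ∘ₗ
    (DirectSum.decomposeLinearEquiv 𝒲).toLinearMap

theorem ofDegree_apply (B : Deg n → W →ₗ[K] M) {a : Deg n} {w : W} (hw : w ∈ 𝒲 a) :
    ofDegree 𝒲 B w = B a w := by
  have h := DirectSum.decomposeLinearEquiv_apply_coe 𝒲 a ⟨w, hw⟩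
  simp only at h
  simp [ofDegree, h]

variable (𝒲) in
/-- The operator `x ↦ (-1)^⟨d, deg x⟩ x` on the tensor algebra. -/
def algSign (d : Deg n) : TensorAlgebra K W →ₗ[K] TensorAlgebra K W :=
  (TensorAlgebra.lift K (ι K ∘ₗ signOp 𝒲 d)).toLinearMap

@[simp]
theorem algSign_one (d : Deg n) : algSign 𝒲 d 1 = 1 := by simp [algSign]

theorem algSign_mul_ι (d : Deg n) {a : Deg n} {w : W} (hw : w ∈ 𝒲 a) (x : TensorAlgebra K W) :
    algSign 𝒲 d (x * ι K w) = (-1 : K) ^ pairing d a • (algSign 𝒲 d x * ι K w) := by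
  simp [algSign, signOp_apply 𝒲 d a hw]

theorem pairing_add_right (d a b : Deg n) : pairing d (a + b) = pairing d a + pairing d b := by
  simp [pairing, mul_add, Finset.sum_add_distrib]

theorem pairing_add_left (a b d : Deg n) : pairing (a + b) d = pairing a d + pairing b d := by
  simp [pairing, add_mul, Finset.sum_add_distrib]

theorem pairing_comm (a b : Deg n) : pairing a b = pairing b a := by
  simp [pairing, mul_comm]

variable (K) in
theorem sign_add (a b : ℤ) : (-1 : K) ^ (a + b) = (-1) ^ a * (-1) ^ b :=
  zpow_add₀ (by simp) a b

variable (K) in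
theorem sign_mul_self (a : ℤ) : (-1 : K) ^ a * (-1) ^ a = 1 := by
  rw [← mul_zpow]; simp

theorem algSign_apply (d : Deg n) {c : Deg n} {x : TensorAlgebra K W} (hx : x ∈ algGrading 𝒲 c) :
    algSign 𝒲 d x = (-1 : K) ^ pairing d c • x := by
  induction hx using Submodule.span_induction with
  | zero => simp
  | add x y _ _ hx hy => rw [map_add, hx, hy, smul_add]
  | smul r x _ hx => rw [map_smul, hx, smul_comm]
  | mem x hx =>
    induction hx with
    | one => simp [pairing]
    | mul hx hw ih =>
      rw [algSign_mul_ι d hw, ih, pairing_add_right, sign_add, smul_mul_assoc, smul_smul, mul_comm]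

variable (𝒲) in
theorem algSign_comp_algSign (a b : Deg n) :
    algSign 𝒲 a ∘ₗ algSign 𝒲 b = algSign 𝒲 (a + b) := by
  refine linearMap_ext_homogeneous 𝒲 fun d x hx => ?_
  simp [algSign_apply _ hx, pairing_add_left, sign_add, smul_smul, mul_comm]

theorem algSign_comp_rmul (d : Deg n) {a : Deg n} {w : W} (hw : w ∈ 𝒲 a) :
    algSign 𝒲 d ∘ₗ rmul w = (-1 : K) ^ pairing d a • (rmul w ∘ₗ algSign 𝒲 d) :=
  LinearMap.ext fun x => algSign_mul_ι d hw x

variable (K W) in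
/-- The augmentation of the tensor algebra. -/
def aug : TensorAlgebra K W →ₗ[K] K := (TensorAlgebra.algebraMapInv (M := W)).toLinearMap

@[simp]
theorem aug_one : aug K W 1 = 1 := by simp [aug]

@[simp]
theorem aug_mul_ι (x : TensorAlgebra K W) (w : W) : aug K W (x * ι K w) = 0 := by
  simp [aug, TensorAlgebra.algebraMapInv]

@[simp]
theorem aug_comp_rmul (w : W) : aug K W ∘ₗ rmul w = 0 := LinearMap.ext fun x => aug_mul_ι x w

variable (𝒲) in
@[simp]
theorem aug_comp_algSign (d : Deg n) : aug K W ∘ₗ algSign 𝒲 d = aug K W := by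
  refine linearMap_ext 𝒲 (by simp) fun x a w hw _ => ?_
  simp [algSign_mul_ι d hw]

end Recursion

/-! ### The unshuffle coproduct: coassociativity, counit, cocommutativity -/

section Unshuffle

variable {K : Type*} [Field K] {n : ℕ} {W : Type*} [AddCommGroup W] [Module K W]
  (𝒲 : Deg n → Submodule K W) [DirectSum.Decomposition 𝒲]
  {M : Type*} [AddCommMonoid M] [Module K M]

open TensorProduct (map)

variable (K W) in
/-- Right multiplication by a letter, linear in the letter. -/
def rmulₗ : W →ₗ[K] TensorAlgebra K W →ₗ[K] TensorAlgebra K W :=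
  (LinearMap.mul K _).flip ∘ₗ ι K

@[simp]
theorem rmulₗ_apply (w : W) : rmulₗ K W w = rmul w := rfl

/-- The operators `x ⊗ y ↦ xw ⊗ (-1)^⟨deg w, deg y⟩ y`. -/
def leftLetter : W →ₗ[K] Module.End K (TensorAlgebra K W ⊗[K] TensorAlgebra K W) :=
  ofDegree 𝒲 fun a => (TensorProduct.mapBilinear (.id K) _ _ _ _).flip (algSign 𝒲 a) ∘ₗ rmulₗ K W

theorem leftLetter_apply {a : Deg n} {w : W} (hw : w ∈ 𝒲 a) :
    leftLetter 𝒲 w = map (rmul w) (algSign 𝒲 a) := by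
  rw [leftLetter, ofDegree_apply _ hw]; rfl

variable (K W M) in
/-- The operators `x ⊗ y ↦ x ⊗ yw`. -/
def rightLetter : W →ₗ[K] Module.End K (M ⊗[K] TensorAlgebra K W) :=
  TensorProduct.mapBilinear (.id K) _ _ _ _ LinearMap.id ∘ₗ rmulₗ K W

@[simp]
theorem rightLetter_apply (w : W) :
    rightLetter K W M w = map LinearMap.id (rmul w) := rfl

/-- The unshuffle coproduct of the tensor algebra. -/
def unshuffle : TensorAlgebra K W →ₗ[K] TensorAlgebra K W ⊗[K] TensorAlgebra K W :=
  recMap (leftLetter 𝒲 + rightLetter K W _) (1 ⊗ₜ 1)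

@[simp]
theorem unshuffle_one : unshuffle 𝒲 1 = 1 ⊗ₜ 1 := by simp [unshuffle]

theorem unshuffle_mul_ι {a : Deg n} {w : W} (hw : w ∈ 𝒲 a) (x : TensorAlgebra K W) :
    unshuffle 𝒲 (x * ι K w) = map (rmul w) (algSign 𝒲 a) (unshuffle 𝒲 x) +
      map LinearMap.id (rmul w) (unshuffle 𝒲 x) := by
  simp [unshuffle, leftLetter_apply 𝒲 hw]

theorem unshuffle_comp_rmul {a : Deg n} {w : W} (hw : w ∈ 𝒲 a) :
    unshuffle 𝒲 ∘ₗ rmul w = map (rmul w) (algSign 𝒲 a) ∘ₗ unshuffle 𝒲 +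
      map LinearMap.id (rmul w) ∘ₗ unshuffle 𝒲 :=
  LinearMap.ext fun x => unshuffle_mul_ι 𝒲 hw x

/-- The sign of a word is the product of the signs of its letters, however they are distributed.
This serves wherever a factor carrying a sign is unshuffled again. -/
theorem unshuffle_comp_algSign (d : Deg n) :
    unshuffle 𝒲 ∘ₗ algSign 𝒲 d = map (algSign 𝒲 d) (algSign 𝒲 d) ∘ₗ unshuffle 𝒲 := by
  refine linearMap_ext 𝒲 (by simp) fun x a w hw ih => ?_
  simp only [LinearMap.comp_apply] at ih ⊢
  rw [algSign_mul_ι d hw, map_smul, unshuffle_mul_ι 𝒲 hw, unshuffle_mul_ι 𝒲 hw, ih]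
  simp only [map_add, TensorProduct.map_map, algSign_comp_rmul d hw, LinearMap.id_comp,
    LinearMap.comp_id, TensorProduct.map_smul_left, TensorProduct.map_smul_right, smul_add,
    LinearMap.smul_apply, algSign_comp_algSign, add_comm]

/-- Both sides obey the same recursion: the last letter joins one of three factors, with the sign of
passing the factors to the right of that one. -/
theorem unshuffle_coassoc (x : TensorAlgebra K W) :
    TensorProduct.assoc K _ _ _ (map (unshuffle 𝒲) LinearMap.id (unshuffle 𝒲 x)) =
      map LinearMap.id (unshuffle 𝒲) (unshuffle 𝒲 x) := by
  suffices h : (TensorProduct.assoc K _ _ _).toLinearMap ∘ₗ map (unshuffle 𝒲) LinearMap.id ∘ₗ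
      unshuffle 𝒲 = map LinearMap.id (unshuffle 𝒲) ∘ₗ unshuffle 𝒲 from LinearMap.congr_fun h x
  refine linearMap_ext 𝒲 (by simp) fun x a w hw ih => ?_
  simp only [LinearMap.comp_apply, LinearEquiv.coe_coe] at ih ⊢
  have e (f g h : TensorAlgebra K W →ₗ[K] TensorAlgebra K W)
      (t : TensorAlgebra K W ⊗[K] TensorAlgebra K W) :
      TensorProduct.assoc K _ _ _ (map (map f g ∘ₗ unshuffle 𝒲) h t) =
      map f (map g h) (TensorProduct.assoc K _ _ _ (map (unshuffle 𝒲) LinearMap.id t)) := by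
    rw [TensorProduct.map_map_assoc, TensorProduct.map_map, LinearMap.comp_id]
  simp only [unshuffle_mul_ι 𝒲 hw, map_add, TensorProduct.map_map, unshuffle_comp_rmul 𝒲 hw,
    TensorProduct.map_add_left, TensorProduct.map_add_right, LinearMap.add_apply,
    LinearMap.id_comp, LinearMap.comp_id, unshuffle_comp_algSign, e]
  have e' : map (unshuffle 𝒲) (rmul w) (unshuffle 𝒲 x) =
      map (map LinearMap.id LinearMap.id ∘ₗ unshuffle 𝒲) (rmul w) (unshuffle 𝒲 x) := by simp
  rw [e', e, ih]
  simp only [TensorProduct.map_map, LinearMap.comp_id, add_assoc]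

theorem aug_unshuffle_left (x : TensorAlgebra K W) :
    map (aug K W) LinearMap.id (unshuffle 𝒲 x) = 1 ⊗ₜ x := by
  suffices h : map (aug K W) LinearMap.id ∘ₗ unshuffle 𝒲 = TensorProduct.mk K _ _ 1 from
    LinearMap.congr_fun h x
  refine linearMap_ext 𝒲 (by simp) fun x a w hw ih => ?_
  simp only [LinearMap.comp_apply, TensorProduct.mk_apply] at ih ⊢
  rw [unshuffle_mul_ι 𝒲 hw, map_add, TensorProduct.map_map, TensorProduct.map_map, aug_comp_rmul,
    TensorProduct.map_zero_left, LinearMap.zero_apply, zero_add, LinearMap.comp_id,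
    LinearMap.id_comp]
  have := congrArg (map LinearMap.id (rmul w)) ih
  rw [TensorProduct.map_map] at this
  simpa using this

theorem aug_unshuffle_right (x : TensorAlgebra K W) :
    map LinearMap.id (aug K W) (unshuffle 𝒲 x) = x ⊗ₜ 1 := by
  suffices h : map LinearMap.id (aug K W) ∘ₗ unshuffle 𝒲 = (TensorProduct.mk K _ _).flip 1 from
    LinearMap.congr_fun h x
  refine linearMap_ext 𝒲 (by simp) fun x a w hw ih => ?_
  simp only [LinearMap.comp_apply, TensorProduct.mk_apply, LinearMap.flip_apply] at ih ⊢
  rw [unshuffle_mul_ι 𝒲 hw, map_add, TensorProduct.map_map, TensorProduct.map_map, aug_comp_rmul,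
    TensorProduct.map_zero_right, LinearMap.zero_apply, add_zero, aug_comp_algSign,
    LinearMap.id_comp]
  have := congrArg (map (rmul w) LinearMap.id) ih
  rw [TensorProduct.map_map] at this
  simpa using this

/-- The map `x ⊗ y ↦ (-1)^⟨deg x, deg y⟩ y ⊗ x`. -/
def braid : TensorAlgebra K W ⊗[K] TensorAlgebra K W →ₗ[K]
    TensorAlgebra K W ⊗[K] TensorAlgebra K W :=
  (TensorProduct.comm K _ _).toLinearMap ∘ₗ TensorProduct.lift
    (LinearMap.flip (recMap
      ((LinearMap.llcomp K (TensorAlgebra K W) _ _) ∘ₗ leftLetter 𝒲)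
      (TensorProduct.mk K _ _ 1)).flip)

/-- The recursion behind `braid` feeds in the letters of `x` one by one, and `leftLetter` supplies
the sign of each letter passing `y`. -/
theorem braid_apply {a b : Deg n} {x y : TensorAlgebra K W} (hx : x ∈ algGrading 𝒲 a)
    (hy : y ∈ algGrading 𝒲 b) : braid 𝒲 (x ⊗ₜ y) = (-1 : K) ^ pairing a b • (y ⊗ₜ x) := by
  suffices h : recMap ((LinearMap.llcomp K (TensorAlgebra K W) _ _) ∘ₗ leftLetter 𝒲)
      (TensorProduct.mk K _ _ 1) x y = (-1 : K) ^ pairing a b • (x ⊗ₜ y) by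
    simp [braid, h]
  induction hx using Submodule.span_induction with
  | zero => simp
  | add x y _ _ hx hy => simp [hx, hy, TensorProduct.add_tmul]
  | smul r x _ hx => rw [map_smul, LinearMap.smul_apply, hx, smul_comm, TensorProduct.smul_tmul']
  | mem x hx =>
    induction hx with
    | one => simp [pairing]
    | mul hx hw ih =>
      simp [ih, leftLetter_apply 𝒲 hw, algSign_apply _ hy, smul_smul, pairing_add_left, sign_add]

theorem tensor_ext_homogeneous {W' : Type*} [AddCommGroup W'] [Module K W']
    (𝒲' : Deg n → Submodule K W') [DirectSum.Decomposition 𝒲']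
    {f g : TensorAlgebra K W ⊗[K] TensorAlgebra K W' →ₗ[K] M}
    (h : ∀ a b, ∀ x ∈ algGrading 𝒲 a, ∀ y ∈ algGrading 𝒲' b, f (x ⊗ₜ y) = g (x ⊗ₜ y)) :
    f = g := by
  refine TensorProduct.ext (linearMap_ext_homogeneous 𝒲 fun a x hx =>
    linearMap_ext_homogeneous 𝒲' fun b y hy => h a b x hx y hy)

/-- The braiding exchanges the two terms of `unshuffle_mul_ι`: this is the content of `h1` and `h2`.
-/
theorem unshuffle_cocomm (x : TensorAlgebra K W) : braid 𝒲 (unshuffle 𝒲 x) = unshuffle 𝒲 x := by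
  suffices h : braid 𝒲 ∘ₗ unshuffle 𝒲 = unshuffle 𝒲 from LinearMap.congr_fun h x
  refine linearMap_ext 𝒲 ?_ fun x a w hw ih => ?_
  · simp [braid_apply 𝒲 one_mem_algGrading one_mem_algGrading, pairing]
  have h1 : braid 𝒲 ∘ₗ map (rmul w) (algSign 𝒲 a) =
      map LinearMap.id (rmul w) ∘ₗ braid 𝒲 := by
    refine tensor_ext_homogeneous 𝒲 𝒲 fun b c y hy z hz => ?_
    simp [braid_apply 𝒲 (mul_ι_mem_algGrading hy hw) hz, braid_apply 𝒲 hy hz, algSign_apply _ hz,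
      smul_smul, pairing_add_left, sign_add]
    rw [mul_comm, mul_assoc, sign_mul_self, mul_one]
  have h2 : braid 𝒲 ∘ₗ map LinearMap.id (rmul w) =
      map (rmul w) (algSign 𝒲 a) ∘ₗ braid 𝒲 := by
    refine tensor_ext_homogeneous 𝒲 𝒲 fun b c y hy z hz => ?_
    simp [braid_apply 𝒲 hy (mul_ι_mem_algGrading hz hw), braid_apply 𝒲 hy hz, algSign_apply _ hy,
      smul_smul, pairing_add_right, sign_add, pairing_comm a b]
  simp only [LinearMap.comp_apply] at ih ⊢
  rw [unshuffle_mul_ι 𝒲 hw, map_add]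
  have h1' := LinearMap.congr_fun h1 (unshuffle 𝒲 x)
  have h2' := LinearMap.congr_fun h2 (unshuffle 𝒲 x)
  simp only [LinearMap.comp_apply, ih] at h1' h2'
  rw [h1', h2', add_comm]

end Unshuffle

/-! ### Gradation of tensor products of tensor algebras -/

section GradedTensor

open TensorProduct (map)

variable {K : Type*} [Field K] {n : ℕ} {W : Type*} [AddCommGroup W] [Module K W]
  (𝒲 : Deg n → Submodule K W) {W' : Type*} [AddCommGroup W'] [Module K W']
  (𝒲' : Deg n → Submodule K W')

/-- The `ℤⁿ`-gradation of the tensor product of two tensor algebras. -/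
def algGrading₂ (d : Deg n) : Submodule K (TensorAlgebra K W ⊗[K] TensorAlgebra K W') :=
  Submodule.span K {t | ∃ a b, ∃ x ∈ algGrading 𝒲 a, ∃ y ∈ algGrading 𝒲' b,
    a + b = d ∧ t = x ⊗ₜ y}

variable {𝒲 𝒲'}

theorem tmul_mem_algGrading₂ {a b d : Deg n} {x : TensorAlgebra K W} {y : TensorAlgebra K W'}
    (hx : x ∈ algGrading 𝒲 a) (hy : y ∈ algGrading 𝒲' b) (h : a + b = d) :
    x ⊗ₜ y ∈ algGrading₂ 𝒲 𝒲' d :=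
  Submodule.subset_span ⟨a, b, x, hx, y, hy, h, rfl⟩

theorem map_mem_algGrading₂ {U U' : Type*} [AddCommGroup U] [Module K U] [AddCommGroup U']
    [Module K U'] {𝒰 : Deg n → Submodule K U} {𝒰' : Deg n → Submodule K U'}
    {f : TensorAlgebra K W →ₗ[K] TensorAlgebra K U}
    {g : TensorAlgebra K W' →ₗ[K] TensorAlgebra K U'} {b c d e : Deg n}
    (hf : ∀ a, ∀ x ∈ algGrading 𝒲 a, f x ∈ algGrading 𝒰 (a + b))
    (hg : ∀ a, ∀ x ∈ algGrading 𝒲' a, g x ∈ algGrading 𝒰' (a + c))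
    {t : TensorAlgebra K W ⊗[K] TensorAlgebra K W'} (ht : t ∈ algGrading₂ 𝒲 𝒲' d)
    (he : d + b + c = e) : map f g t ∈ algGrading₂ 𝒰 𝒰' e := by
  have h : algGrading₂ 𝒲 𝒲' d ≤ (algGrading₂ 𝒰 𝒰' e).comap (map f g) := by
    refine Submodule.span_le.2 ?_
    rintro _ ⟨p, q, x, hx, y, hy, rfl, rfl⟩
    exact tmul_mem_algGrading₂ (hf p x hx) (hg q y hy) (by rw [← he]; abel)
  exact h ht

theorem map_mem_of_monomial {M : Type*} [AddCommMonoid M] [Module K M]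
    {f : TensorAlgebra K W →ₗ[K] M} {P : Deg n → Submodule K M}
    (h1 : f 1 ∈ P 0) (hmul : ∀ d a x, ∀ w ∈ 𝒲 a, f x ∈ P d → f (x * ι K w) ∈ P (d + a))
    {d : Deg n} {x : TensorAlgebra K W} (hx : x ∈ algGrading 𝒲 d) : f x ∈ P d := by
  have h : algGrading 𝒲 d ≤ (P d).comap f := by
    clear hx
    refine Submodule.span_le.2 fun y hy => ?_
    induction hy with
    | one => exact h1
    | mul _ hw ih => exact hmul _ _ _ _ hw ih
  exact h hx

end GradedTensor

/-! ### The cohomomorphism with a given corestriction, on full tensor algebras -/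

section Lift

open TensorProduct (map)

variable {K : Type*} [Field K] {n : ℕ} {W : Type*} [AddCommGroup W] [Module K W]
  (𝒲 : Deg n → Submodule K W) [DirectSum.Decomposition 𝒲]
  {W' : Type*} [AddCommGroup W'] [Module K W']
  (𝒲' : Deg n → Submodule K W')

/-- The maps `y ⊗ z ↦ y φ(zw)`. -/
def attach (φ : TensorAlgebra K W →ₗ[K] W') :
    W →ₗ[K] TensorAlgebra K W' ⊗[K] TensorAlgebra K W →ₗ[K] TensorAlgebra K W' where
  toFun w := TensorProduct.lift (rmulₗ K W').flip ∘ₗ map LinearMap.id (φ ∘ₗ rmul w)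
  map_add' u v := by
    rw [← LinearMap.comp_add, ← TensorProduct.map_add_right, ← LinearMap.comp_add]
    simp only [← rmulₗ_apply, map_add]
  map_smul' c u := by
    rw [RingHom.id_apply, ← LinearMap.comp_smul, ← TensorProduct.map_smul_right,
      ← LinearMap.comp_smul]
    simp only [← rmulₗ_apply, map_smul]

@[simp]
theorem attach_tmul (φ : TensorAlgebra K W →ₗ[K] W') (w : W) (y : TensorAlgebra K W')
    (z : TensorAlgebra K W) : attach φ w (y ⊗ₜ z) = y * ι K (φ (z * ι K w)) := rfl

/-- The maps `y ⊗ z ↦ ∑ y φ(z₁w) ⊗ (-1)^⟨a, deg z₂⟩ z₂`, where `∑ z₁ ⊗ z₂` is the unshuffle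
coproduct of `z`. -/
def liftStep (φ : TensorAlgebra K W →ₗ[K] W') (a : Deg n) :
    W →ₗ[K] Module.End K (TensorAlgebra K W' ⊗[K] TensorAlgebra K W) where
  toFun w := map (attach φ w) (algSign 𝒲 a) ∘ₗ (TensorProduct.assoc K _ _ _).symm.toLinearMap ∘ₗ
    map LinearMap.id (unshuffle 𝒲)
  map_add' u v := by
    rw [← LinearMap.add_comp, ← TensorProduct.map_add_left, map_add]
  map_smul' c u := by
    rw [RingHom.id_apply, ← LinearMap.smul_comp, ← TensorProduct.map_smul_left, map_smul]

theorem liftStep_apply (φ : TensorAlgebra K W →ₗ[K] W') (a : Deg n) (w : W)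
    (t : TensorAlgebra K W' ⊗[K] TensorAlgebra K W) :
    liftStep 𝒲 φ a w t = map (attach φ w) (algSign 𝒲 a)
      ((TensorProduct.assoc K _ _ _).symm (map LinearMap.id (unshuffle 𝒲) t)) := rfl

theorem liftStep_tmul (φ : TensorAlgebra K W →ₗ[K] W') (a : Deg n) (w : W)
    (y : TensorAlgebra K W') (z : TensorAlgebra K W) :
    liftStep 𝒲 φ a w (y ⊗ₜ z) =
      map (attach φ w ∘ₗ TensorProduct.mk K _ _ y) (algSign 𝒲 a) (unshuffle 𝒲 z) := by
  rw [liftStep_apply, TensorProduct.map_tmul, LinearMap.id_apply]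
  induction unshuffle 𝒲 z using TensorProduct.induction_on with
  | zero => simp
  | tmul p q => simp
  | add s t hs ht => rw [TensorProduct.tmul_add, map_add, map_add, hs, ht, map_add]

/-- The map `x ↦ ∑ F(x₁) ⊗ x₂`, where `F` is the cohomomorphism with corestriction `φ`. -/
def liftAux (φ : TensorAlgebra K W →ₗ[K] W') :
    TensorAlgebra K W →ₗ[K] TensorAlgebra K W' ⊗[K] TensorAlgebra K W :=
  recMap (ofDegree 𝒲 (liftStep 𝒲 φ) + rightLetter K W _) (1 ⊗ₜ 1)

/-- The cohomomorphism with corestriction `φ`, on the full tensor algebras. -/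
def cohomLift (φ : TensorAlgebra K W →ₗ[K] W') : TensorAlgebra K W →ₗ[K] TensorAlgebra K W' :=
  (TensorProduct.rid K _).toLinearMap ∘ₗ map LinearMap.id (aug K W) ∘ₗ liftAux 𝒲 φ

variable (φ : TensorAlgebra K W →ₗ[K] W')

@[simp]
theorem liftAux_one : liftAux 𝒲 φ 1 = 1 ⊗ₜ 1 := by simp [liftAux]

theorem liftAux_mul_ι {a : Deg n} {w : W} (hw : w ∈ 𝒲 a) (x : TensorAlgebra K W) :
    liftAux 𝒲 φ (x * ι K w) = liftStep 𝒲 φ a w (liftAux 𝒲 φ x) +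
      map LinearMap.id (rmul w) (liftAux 𝒲 φ x) := by
  simp [liftAux, ofDegree_apply _ hw]

/-- On `y ⊗ z` both sides are `∑ y φ(z₁w) ⊗ z₂ ⊗ z₃`, with the signs of `z₂` and `z₃` against `a`;
only coassociativity is involved. -/
theorem unshuffle_liftStep (a : Deg n) (w : W) (g : TensorAlgebra K W' ⊗[K] TensorAlgebra K W) :
    TensorProduct.assoc K _ _ _ (map (liftStep 𝒲 φ a w) (algSign 𝒲 a)
      ((TensorProduct.assoc K _ _ _).symm (map LinearMap.id (unshuffle 𝒲) g))) =
    map LinearMap.id (unshuffle 𝒲) (liftStep 𝒲 φ a w g) := by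
  induction g using TensorProduct.induction_on with
  | zero => simp
  | add s t hs ht => simp only [map_add, hs, ht]
  | tmul y z =>
    have key : ∀ t, TensorProduct.assoc K _ _ _ (map (liftStep 𝒲 φ a w) (algSign 𝒲 a)
        ((TensorProduct.assoc K _ _ _).symm (y ⊗ₜ t))) =
        map (attach φ w ∘ₗ TensorProduct.mk K _ _ y) (map (algSign 𝒲 a) (algSign 𝒲 a))
          (TensorProduct.assoc K _ _ _ (map (unshuffle 𝒲) LinearMap.id t)) := by
      intro t
      induction t using TensorProduct.induction_on with
      | zero => simp
      | add s t hs ht => simp only [TensorProduct.tmul_add, map_add, hs, ht]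
      | tmul p q =>
        rw [TensorProduct.map_map_assoc, TensorProduct.assoc_symm_tmul, TensorProduct.map_tmul,
          liftStep_tmul, TensorProduct.map_tmul, TensorProduct.map_tmul, LinearMap.id_apply]
    rw [TensorProduct.map_tmul, LinearMap.id_apply, key, unshuffle_coassoc, liftStep_tmul,
      TensorProduct.map_map, TensorProduct.map_map, unshuffle_comp_algSign, LinearMap.id_comp,
      LinearMap.comp_id]

/-- If `liftAux` is to be `∑ F(x₁) ⊗ x₂`, it must inherit coassociativity. This is checked on the
last-letter recursion, before `F` is known to satisfy any formula. -/
theorem liftAux_coassoc (x : TensorAlgebra K W) :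
    map (liftAux 𝒲 φ) LinearMap.id (unshuffle 𝒲 x) =
      (TensorProduct.assoc K _ _ _).symm (map LinearMap.id (unshuffle 𝒲) (liftAux 𝒲 φ x)) := by
  suffices h : map (liftAux 𝒲 φ) LinearMap.id ∘ₗ unshuffle 𝒲 =
      (TensorProduct.assoc K _ _ _).symm.toLinearMap ∘ₗ
        map LinearMap.id (unshuffle 𝒲) ∘ₗ liftAux 𝒲 φ from LinearMap.congr_fun h x
  refine linearMap_ext 𝒲 (by simp) fun x a w hw ih => ?_
  simp only [LinearMap.comp_apply, LinearEquiv.coe_coe] at ih ⊢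
  rw [LinearEquiv.eq_symm_apply]
  have hG : liftAux 𝒲 φ ∘ₗ rmul w = liftStep 𝒲 φ a w ∘ₗ liftAux 𝒲 φ +
      map LinearMap.id (rmul w) ∘ₗ liftAux 𝒲 φ := LinearMap.ext fun x => liftAux_mul_ι 𝒲 φ hw x
  have e1 : map (liftStep 𝒲 φ a w ∘ₗ liftAux 𝒲 φ) (algSign 𝒲 a) (unshuffle 𝒲 x) =
      map (liftStep 𝒲 φ a w) (algSign 𝒲 a) (map (liftAux 𝒲 φ) LinearMap.id (unshuffle 𝒲 x)) := by
    rw [TensorProduct.map_map, LinearMap.comp_id]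
  have e2 (f g : TensorAlgebra K W →ₗ[K] TensorAlgebra K W) :
      map (map LinearMap.id f ∘ₗ liftAux 𝒲 φ) g (unshuffle 𝒲 x) =
      map (map LinearMap.id f) g (map (liftAux 𝒲 φ) LinearMap.id (unshuffle 𝒲 x)) := by
    rw [TensorProduct.map_map, LinearMap.comp_id]
  have e3 : map (liftAux 𝒲 φ) (rmul w) (unshuffle 𝒲 x) =
      map (map LinearMap.id LinearMap.id ∘ₗ liftAux 𝒲 φ) (rmul w) (unshuffle 𝒲 x) := by
    rw [TensorProduct.map_id, LinearMap.id_comp]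
  rw [unshuffle_mul_ι 𝒲 hw, map_add, TensorProduct.map_map, TensorProduct.map_map, hG,
    LinearMap.id_comp, LinearMap.id_comp, LinearMap.comp_id, TensorProduct.map_add_left,
    LinearMap.add_apply, e1, e3, e2, e2, ih, map_add, map_add, unshuffle_liftStep,
    ← TensorProduct.map_map_assoc, ← TensorProduct.map_map_assoc, LinearEquiv.apply_symm_apply,
    liftAux_mul_ι 𝒲 φ hw, map_add, TensorProduct.map_map LinearMap.id (unshuffle 𝒲),
    unshuffle_comp_rmul 𝒲 hw, TensorProduct.map_add_right, LinearMap.add_apply,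
    TensorProduct.map_map, TensorProduct.map_map, add_assoc]

/-- Apply the counit to the middle factor in `liftAux_coassoc`. -/
theorem map_cohomLift_unshuffle (x : TensorAlgebra K W) :
    map (cohomLift 𝒲 φ) LinearMap.id (unshuffle 𝒲 x) = liftAux 𝒲 φ x := by
  have h : (map ((TensorProduct.rid K (TensorAlgebra K W')).toLinearMap ∘ₗ
      map LinearMap.id (aug K W)) LinearMap.id : _ →ₗ[K] _ ⊗[K] TensorAlgebra K W) =
      map LinearMap.id ((TensorProduct.lid K _).toLinearMap ∘ₗ map (aug K W) LinearMap.id) ∘ₗ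
        (TensorProduct.assoc K _ _ _).toLinearMap := by
    refine TensorProduct.ext_threefold fun y p q => ?_
    simp [TensorProduct.smul_tmul]
  have h' : ((TensorProduct.lid K _).toLinearMap ∘ₗ map (aug K W) LinearMap.id) ∘ₗ unshuffle 𝒲 =
      LinearMap.id := by
    ext1 x
    simp [aug_unshuffle_left]
  have e : map (cohomLift 𝒲 φ) LinearMap.id (unshuffle 𝒲 x) =
      map ((TensorProduct.rid K (TensorAlgebra K W')).toLinearMap ∘ₗ
      map LinearMap.id (aug K W)) LinearMap.id
        (map (liftAux 𝒲 φ) LinearMap.id (unshuffle 𝒲 x)) := by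
    rw [TensorProduct.map_map, LinearMap.comp_id]; rfl
  rw [e, liftAux_coassoc, h, LinearMap.comp_apply, LinearEquiv.coe_coe,
    LinearEquiv.apply_symm_apply, TensorProduct.map_map, h', LinearMap.id_comp,
    TensorProduct.map_id, LinearMap.id_apply]

@[simp]
theorem cohomLift_one : cohomLift 𝒲 φ 1 = 1 := by simp [cohomLift]

/-- This is the recursion `F(xw) = ∑ F(x₁) φ(x₂w)`. In `liftAux_mul_ι` the augmentation kills the
term with `w` on the right, and in `liftStep` it keeps only the part where all of `z` goes into `φ`.
-/
theorem cohomLift_mul_ι {a : Deg n} {w : W} (hw : w ∈ 𝒲 a) (x : TensorAlgebra K W) :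
    cohomLift 𝒲 φ (x * ι K w) =
      attach φ w (map (cohomLift 𝒲 φ) LinearMap.id (unshuffle 𝒲 x)) := by
  have h : ∀ g, TensorProduct.rid K _ (map LinearMap.id (aug K W) (liftStep 𝒲 φ a w g)) =
      attach φ w g := by
    intro g
    induction g using TensorProduct.induction_on with
    | zero => simp
    | add s t hs ht => simp only [map_add, hs, ht]
    | tmul y z =>
      have e : map (attach φ w ∘ₗ TensorProduct.mk K _ _ y) (aug K W) (unshuffle 𝒲 z) =
          map (attach φ w ∘ₗ TensorProduct.mk K _ _ y) LinearMap.id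
            (map LinearMap.id (aug K W) (unshuffle 𝒲 z)) := by
        rw [TensorProduct.map_map, LinearMap.comp_id, LinearMap.id_comp]
      rw [liftStep_tmul, TensorProduct.map_map, aug_comp_algSign, LinearMap.id_comp, e,
        aug_unshuffle_right]
      simp
  rw [map_cohomLift_unshuffle]
  simp only [cohomLift, LinearMap.comp_apply, liftAux_mul_ι 𝒲 φ hw, map_add, LinearEquiv.coe_coe,
    h]
  rw [TensorProduct.map_map, aug_comp_rmul, TensorProduct.map_zero_right]
  simp

variable {φ} in
/-- The cohomomorphism with corestriction `φ` is determined by its recursion. -/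
theorem eq_cohomLift {F : TensorAlgebra K W →ₗ[K] TensorAlgebra K W'} (h1 : F 1 = 1)
    (hmul : ∀ a, ∀ w ∈ 𝒲 a, ∀ x,
      F (x * ι K w) = attach φ w (map F LinearMap.id (unshuffle 𝒲 x))) :
    F = cohomLift 𝒲 φ := by
  -- The hypothesis on `F` becomes a last-letter recursion only for `∑ F(x₁) ⊗ x₂`; the counit then
  -- gives back `F`.
  have key : map F LinearMap.id ∘ₗ unshuffle 𝒲 = liftAux 𝒲 φ := by
    refine linearMap_ext 𝒲 (by simp [h1]) fun x a w hw ih => ?_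
    have hF : F ∘ₗ rmul w = (attach φ w ∘ₗ map F LinearMap.id) ∘ₗ unshuffle 𝒲 :=
      LinearMap.ext fun x => hmul a w hw x
    have e1 : map F (rmul w) (unshuffle 𝒲 x) =
        map LinearMap.id (rmul w) (map F LinearMap.id (unshuffle 𝒲 x)) := by
      rw [TensorProduct.map_map, LinearMap.comp_id, LinearMap.id_comp]
    have e2 : map ((attach φ w ∘ₗ map F LinearMap.id) ∘ₗ unshuffle 𝒲) (algSign 𝒲 a)
        (unshuffle 𝒲 x) = map (attach φ w) (algSign 𝒲 a) (map (map F LinearMap.id) LinearMap.id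
          (map (unshuffle 𝒲) LinearMap.id (unshuffle 𝒲 x))) := by
      rw [TensorProduct.map_map, TensorProduct.map_map, LinearMap.comp_id, LinearMap.comp_id,
        LinearMap.comp_assoc]
    have e3 : map (unshuffle 𝒲) LinearMap.id (unshuffle 𝒲 x) =
        (TensorProduct.assoc K _ _ _).symm (map LinearMap.id (unshuffle 𝒲) (unshuffle 𝒲 x)) := by
      rw [LinearEquiv.eq_symm_apply, unshuffle_coassoc]
    have e4 (t) : map (map F LinearMap.id) LinearMap.id ((TensorProduct.assoc K _ _ _).symm t) =
        (TensorProduct.assoc K _ _ (TensorAlgebra K W)).symm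
          (map F (LinearMap.id (M := TensorAlgebra K W ⊗[K] TensorAlgebra K W)) t) := by
      rw [LinearEquiv.eq_symm_apply, ← TensorProduct.map_map_assoc, LinearEquiv.apply_symm_apply,
        TensorProduct.map_id]
    have e5 : map F (LinearMap.id) (map LinearMap.id (unshuffle 𝒲) (unshuffle 𝒲 x)) =
        map LinearMap.id (unshuffle 𝒲) (map F LinearMap.id (unshuffle 𝒲 x)) := by
      rw [TensorProduct.map_map, TensorProduct.map_map, LinearMap.comp_id, LinearMap.id_comp,
        LinearMap.comp_id, LinearMap.id_comp]
    simp only [LinearMap.comp_apply] at ih ⊢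
    rw [unshuffle_mul_ι 𝒲 hw, map_add, TensorProduct.map_map, TensorProduct.map_map, hF,
      LinearMap.id_comp, LinearMap.id_comp, LinearMap.comp_id, e1, e2, e3, e4, e5, ih,
      ← liftStep_apply, liftAux_mul_ι 𝒲 φ hw]
  ext1 x
  have e : map LinearMap.id (aug K W) (map F LinearMap.id (unshuffle 𝒲 x)) =
      map F LinearMap.id (map LinearMap.id (aug K W) (unshuffle 𝒲 x)) := by
    rw [TensorProduct.map_map, TensorProduct.map_map, LinearMap.comp_id, LinearMap.id_comp,
      LinearMap.comp_id, LinearMap.id_comp]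
  rw [cohomLift, ← key, LinearMap.comp_apply, LinearMap.comp_apply, LinearMap.comp_apply, e,
    aug_unshuffle_right]
  simp

@[simp]
theorem aug_comp_attach (w : W) : aug K W' ∘ₗ attach φ w = 0 :=
  TensorProduct.ext' fun y z => by simp

theorem aug_comp_cohomLift : aug K W' ∘ₗ cohomLift 𝒲 φ = aug K W := by
  refine linearMap_ext 𝒲 (by simp) fun x a w hw _ => ?_
  rw [LinearMap.comp_apply, cohomLift_mul_ι 𝒲 φ hw, ← LinearMap.comp_apply, aug_comp_attach]
  simp

/-! ### Weights -/

variable {𝒲 𝒲'}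

theorem algSign_mem {a d : Deg n} {x : TensorAlgebra K W} (hx : x ∈ algGrading 𝒲 d) :
    algSign 𝒲 a x ∈ algGrading 𝒲 (d + 0) := by
  rw [algSign_apply a hx, add_zero]
  exact Submodule.smul_mem _ _ hx

theorem unshuffle_mem {d : Deg n} {x : TensorAlgebra K W} (hx : x ∈ algGrading 𝒲 d) :
    unshuffle 𝒲 x ∈ algGrading₂ 𝒲 𝒲 d := by
  refine map_mem_of_monomial (P := algGrading₂ 𝒲 𝒲) ?_ (fun d a x w hw ih => ?_) hx
  · rw [unshuffle_one]
    exact tmul_mem_algGrading₂ one_mem_algGrading one_mem_algGrading (by simp)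
  · rw [unshuffle_mul_ι 𝒲 hw]
    refine add_mem (map_mem_algGrading₂ (fun _ _ h => mul_ι_mem_algGrading h hw)
      (fun _ _ h => algSign_mem h) ih (by simp)) (map_mem_algGrading₂ (b := 0) (fun _ _ h => ?_)
      (fun _ _ h => mul_ι_mem_algGrading h hw) ih (by simp))
    simpa using h

variable {φ}

theorem liftStep_mem (hφ : ∀ d, ∀ x ∈ algGrading 𝒲 d, φ x ∈ 𝒲' d) {a d : Deg n} {w : W}
    (hw : w ∈ 𝒲 a) {t : TensorAlgebra K W' ⊗[K] TensorAlgebra K W}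
    (ht : t ∈ algGrading₂ 𝒲' 𝒲 d) :
    liftStep 𝒲 φ a w t ∈ algGrading₂ 𝒲' 𝒲 (d + a) := by
  have h : algGrading₂ 𝒲' 𝒲 d ≤ (algGrading₂ 𝒲' 𝒲 (d + a)).comap (liftStep 𝒲 φ a w) := by
    refine Submodule.span_le.2 ?_
    rintro _ ⟨p, q, y, hy, z, hz, rfl, rfl⟩
    simp only [Submodule.comap_coe, Set.mem_preimage, SetLike.mem_coe, liftStep_tmul]
    refine map_mem_algGrading₂ (b := p + a) (c := 0) (fun b x hx => ?_)
      (fun _ _ h => algSign_mem h) (unshuffle_mem hz) (by abel)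
    have := mul_ι_mem_algGrading hy (hφ _ _ (mul_ι_mem_algGrading hx hw))
    rwa [show p + (b + a) = b + (p + a) by abel] at this
  exact h ht

theorem cohomLift_mem (hφ : ∀ d, ∀ x ∈ algGrading 𝒲 d, φ x ∈ 𝒲' d) {d : Deg n}
    {x : TensorAlgebra K W} (hx : x ∈ algGrading 𝒲 d) : cohomLift 𝒲 φ x ∈ algGrading 𝒲' d := by
  have h : liftAux 𝒲 φ x ∈ algGrading₂ 𝒲' 𝒲 d := by
    refine map_mem_of_monomial (P := algGrading₂ 𝒲' 𝒲) ?_ (fun d a x w hw ih => ?_) hx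
    · rw [liftAux_one]
      exact tmul_mem_algGrading₂ one_mem_algGrading one_mem_algGrading (by simp)
    · rw [liftAux_mul_ι 𝒲 φ hw]
      refine add_mem (liftStep_mem hφ hw ih) (map_mem_algGrading₂ (b := 0) (fun _ _ h => ?_)
        (fun _ _ h => mul_ι_mem_algGrading h hw) ih (by simp))
      simpa using h
  -- The augmentation is concentrated in degree `0`, so applying it to the right factor preserves
  -- the total degree.
  have haug : ∀ b, ∀ z ∈ algGrading 𝒲 b, b ≠ 0 → aug K W z = 0 := by
    intro b z hz
    induction hz using Submodule.span_induction with
    | zero => simp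
    | add x y _ _ hx hy => intro hb; rw [map_add, hx hb, hy hb, add_zero]
    | smul r x _ hx => intro hb; rw [map_smul, hx hb, smul_zero]
    | mem x hx =>
      cases hx with
      | one => intro hb; exact absurd rfl hb
      | mul => simp
  have h' : algGrading₂ 𝒲' 𝒲 d ≤ (algGrading 𝒲' d).comap
      ((TensorProduct.rid K _).toLinearMap ∘ₗ map LinearMap.id (aug K W)) := by
    refine Submodule.span_le.2 ?_
    rintro _ ⟨p, q, y, hy, z, hz, rfl, rfl⟩
    by_cases hq : q = 0
    · subst hq
      simpa using Submodule.smul_mem _ _ hy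
    · simp [haug q z hz hq]
  exact h' h

variable [DirectSum.Decomposition 𝒲']

/-! ### Compatibility with the coproducts -/

variable (φ 𝒲')

/-- The maps `u ⊗ z ↦ u · φ(zw)`, for the two actions of letters on `T(W') ⊗ T(W')`. -/
def actLetter (A : W' →ₗ[K] Module.End K (TensorAlgebra K W' ⊗[K] TensorAlgebra K W')) (w : W) :
    (TensorAlgebra K W' ⊗[K] TensorAlgebra K W') ⊗[K] TensorAlgebra K W →ₗ[K]
      TensorAlgebra K W' ⊗[K] TensorAlgebra K W' :=
  TensorProduct.lift (LinearMap.flip A) ∘ₗ map LinearMap.id (φ ∘ₗ rmul w)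

@[simp]
theorem actLetter_tmul (A : W' →ₗ[K] Module.End K (TensorAlgebra K W' ⊗[K] TensorAlgebra K W'))
    (w : W) (u : TensorAlgebra K W' ⊗[K] TensorAlgebra K W') (z : TensorAlgebra K W) :
    actLetter φ A w (u ⊗ₜ z) = A (φ (z * ι K w)) u := rfl

theorem unshuffle_comp_attach (w : W) : unshuffle 𝒲' ∘ₗ attach φ w =
    (actLetter φ (leftLetter 𝒲') w + actLetter φ (rightLetter K W' _) w) ∘ₗ
      map (unshuffle 𝒲') LinearMap.id := by
  refine TensorProduct.ext' fun y z => ?_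
  simp [unshuffle]

variable {φ}

/-- The letter `φ(zw)` passes `F(q)`. Its degree is that of `z` plus `a`: the part from `z` gives
the sign of the braiding of `q` and `z`, the part `a` gives `algSign`. -/
theorem actLetter_left (hφ : ∀ d, ∀ x ∈ algGrading 𝒲 d, φ x ∈ 𝒲' d) {a : Deg n} {w : W}
    (hw : w ∈ 𝒲 a) (t : TensorAlgebra K W ⊗[K] (TensorAlgebra K W ⊗[K] TensorAlgebra K W)) :
    actLetter φ (leftLetter 𝒲') w (map (map (cohomLift 𝒲 φ) (cohomLift 𝒲 φ)) LinearMap.id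
      ((TensorProduct.assoc K _ _ _).symm t)) =
    map (attach φ w ∘ₗ map (cohomLift 𝒲 φ) LinearMap.id) (cohomLift 𝒲 φ ∘ₗ algSign 𝒲 a)
      ((TensorProduct.assoc K _ _ _).symm (map LinearMap.id (braid 𝒲) t)) := by
  induction t using TensorProduct.induction_on with
  | zero => simp
  | add s t hs ht => simp only [map_add, hs, ht]
  | tmul p r =>
    suffices h : actLetter φ (leftLetter 𝒲') w ∘ₗ
        map (map (cohomLift 𝒲 φ) (cohomLift 𝒲 φ)) LinearMap.id ∘ₗ
        (TensorProduct.assoc K _ _ _).symm.toLinearMap ∘ₗ TensorProduct.mk K _ _ p =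
      map (attach φ w ∘ₗ map (cohomLift 𝒲 φ) LinearMap.id) (cohomLift 𝒲 φ ∘ₗ algSign 𝒲 a) ∘ₗ
        (TensorProduct.assoc K _ _ _).symm.toLinearMap ∘ₗ TensorProduct.mk K _ _ p ∘ₗ braid 𝒲 from
      LinearMap.congr_fun h r
    refine tensor_ext_homogeneous 𝒲 𝒲 fun b c q hq z hz => ?_
    simp [braid_apply 𝒲 hq hz, leftLetter_apply 𝒲' (hφ _ _ (mul_ι_mem_algGrading hz hw)),
      algSign_apply _ (cohomLift_mem hφ hq), algSign_apply _ hq, pairing_add_left, sign_add,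
      smul_smul, pairing_comm c b]

theorem actLetter_right {a : Deg n} {w : W} (hw : w ∈ 𝒲 a) (x : TensorAlgebra K W) :
    actLetter φ (rightLetter K W' _) w (map (map (cohomLift 𝒲 φ) (cohomLift 𝒲 φ)) LinearMap.id
      ((TensorProduct.assoc K _ _ _).symm (map LinearMap.id (unshuffle 𝒲) (unshuffle 𝒲 x)))) =
    map (cohomLift 𝒲 φ) (cohomLift 𝒲 φ ∘ₗ rmul w) (unshuffle 𝒲 x) := by
  have h : actLetter φ (rightLetter K W' _) w ∘ₗ
      map (map (cohomLift 𝒲 φ) (cohomLift 𝒲 φ)) LinearMap.id ∘ₗ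
        (TensorProduct.assoc K _ _ _).symm.toLinearMap =
      map (cohomLift 𝒲 φ) (attach φ w ∘ₗ map (cohomLift 𝒲 φ) LinearMap.id) := by
    ext : 1
    ext p : 1
    refine TensorProduct.ext' fun q z => ?_
    simp
  have hF : cohomLift 𝒲 φ ∘ₗ rmul w =
      (attach φ w ∘ₗ map (cohomLift 𝒲 φ) LinearMap.id) ∘ₗ unshuffle 𝒲 :=
    LinearMap.ext fun x => cohomLift_mul_ι 𝒲 φ hw x
  rw [hF]
  refine (LinearMap.congr_fun h _).trans ?_
  rw [TensorProduct.map_map, LinearMap.comp_id]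

theorem map_unshuffle_unshuffle {M : Type*} [AddCommMonoid M] [Module K M]
    (f : TensorAlgebra K W →ₗ[K] M) (x : TensorAlgebra K W) :
    map (map f LinearMap.id ∘ₗ unshuffle 𝒲) LinearMap.id (unshuffle 𝒲 x) =
    (TensorProduct.assoc K _ _ _).symm
      (map LinearMap.id (unshuffle 𝒲) (map f LinearMap.id (unshuffle 𝒲 x))) := by
  have e : map LinearMap.id (unshuffle 𝒲) (map f LinearMap.id (unshuffle 𝒲 x)) =
      map f (map LinearMap.id LinearMap.id)
        (map LinearMap.id (unshuffle 𝒲) (unshuffle 𝒲 x)) := by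
    simp [TensorProduct.map_map]
  rw [LinearEquiv.eq_symm_apply, e, ← unshuffle_coassoc, TensorProduct.map_map_assoc,
    TensorProduct.map_map, LinearMap.comp_id]

/-- In the unshuffle of `F(x₁) φ(x₂w)`, the letter `φ(x₂w)` joins either factor. Joining the right
one gives `F(x₁) ⊗ F(x₂w)` by coassociativity; joining the left one gives `F(x₁w) ⊗ F(x₂)`, up to
sign, after exchanging two factors by cocommutativity. -/
theorem unshuffle_comp_cohomLift (hφ : ∀ d, ∀ x ∈ algGrading 𝒲 d, φ x ∈ 𝒲' d) :
    unshuffle 𝒲' ∘ₗ cohomLift 𝒲 φ =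
      map (cohomLift 𝒲 φ) (cohomLift 𝒲 φ) ∘ₗ unshuffle 𝒲 := by
  set F := cohomLift 𝒲 φ with hFdef
  -- The value at `xw` depends on all the `x₁`, so the induction must carry the equality on every
  -- left factor of the unshuffle.
  have key : map (unshuffle 𝒲' ∘ₗ F) LinearMap.id ∘ₗ unshuffle 𝒲 =
      map (map F F ∘ₗ unshuffle 𝒲) LinearMap.id ∘ₗ unshuffle 𝒲 := by
    refine linearMap_ext 𝒲 (by simp [hFdef]) fun x a w hw ih => ?_
    simp only [LinearMap.comp_apply] at ih ⊢
    set Λ := actLetter φ (leftLetter 𝒲') w + actLetter φ (rightLetter K W' _) w with hΛ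
    have h1 : (unshuffle 𝒲' ∘ₗ F) ∘ₗ rmul w =
        Λ ∘ₗ map (unshuffle 𝒲' ∘ₗ F) LinearMap.id ∘ₗ unshuffle 𝒲 := by
      have hF : F ∘ₗ rmul w = attach φ w ∘ₗ map F LinearMap.id ∘ₗ unshuffle 𝒲 :=
        LinearMap.ext fun x => cohomLift_mul_ι 𝒲 φ hw x
      rw [LinearMap.comp_assoc, hF, ← LinearMap.comp_assoc, unshuffle_comp_attach,
        LinearMap.comp_assoc, ← LinearMap.comp_assoc _ (map F _), ← TensorProduct.map_comp,
        LinearMap.comp_id]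
    have h2 : (map F F ∘ₗ unshuffle 𝒲) ∘ₗ rmul w =
        Λ ∘ₗ map (map F F ∘ₗ unshuffle 𝒲) LinearMap.id ∘ₗ unshuffle 𝒲 := by
      ext1 y
      have e : map (map F F ∘ₗ unshuffle 𝒲) LinearMap.id (unshuffle 𝒲 y) =
          map (map F F) LinearMap.id ((TensorProduct.assoc K _ _ _).symm
            (map LinearMap.id (unshuffle 𝒲) (unshuffle 𝒲 y))) := by
        rw [← unshuffle_coassoc, LinearEquiv.symm_apply_apply, TensorProduct.map_map,
          LinearMap.comp_id]
      -- Cocommutativity enters here, absorbing the braiding produced by `actLetter_left`.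
      have e' : map LinearMap.id (braid 𝒲) (map LinearMap.id (unshuffle 𝒲) (unshuffle 𝒲 y)) =
          map LinearMap.id (unshuffle 𝒲) (unshuffle 𝒲 y) := by
        rw [TensorProduct.map_map, LinearMap.id_comp,
          show braid 𝒲 ∘ₗ unshuffle 𝒲 = unshuffle 𝒲 from LinearMap.ext (unshuffle_cocomm 𝒲)]
      have hF : F ∘ₗ rmul w = (attach φ w ∘ₗ map F LinearMap.id) ∘ₗ unshuffle 𝒲 :=
        LinearMap.ext fun x => cohomLift_mul_ι 𝒲 φ hw x
      simp only [LinearMap.comp_apply, rmul_apply]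
      rw [e, hΛ, LinearMap.add_apply, hFdef, actLetter_left 𝒲' hφ hw, e', actLetter_right hw,
        ← unshuffle_coassoc, LinearEquiv.symm_apply_apply, unshuffle_mul_ι 𝒲 hw, map_add,
        TensorProduct.map_map, TensorProduct.map_map, TensorProduct.map_map, ← hFdef, hF,
        LinearMap.comp_id, LinearMap.comp_id]
    have h3 (f : TensorAlgebra K W →ₗ[K] TensorAlgebra K W' ⊗[K] TensorAlgebra K W') :
        map (Λ ∘ₗ map f LinearMap.id ∘ₗ unshuffle 𝒲) (algSign 𝒲 a) (unshuffle 𝒲 x) =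
        map Λ (algSign 𝒲 a) ((TensorProduct.assoc K _ _ _).symm
          (map LinearMap.id (unshuffle 𝒲) (map f LinearMap.id (unshuffle 𝒲 x)))) := by
      rw [← map_unshuffle_unshuffle, TensorProduct.map_map, LinearMap.comp_id]
    have h4 (f : TensorAlgebra K W →ₗ[K] TensorAlgebra K W' ⊗[K] TensorAlgebra K W') :
        map f (rmul w) (unshuffle 𝒲 x) =
        map LinearMap.id (rmul w) (map f LinearMap.id (unshuffle 𝒲 x)) := by
      rw [TensorProduct.map_map, LinearMap.comp_id, LinearMap.id_comp]
    rw [unshuffle_mul_ι 𝒲 hw, map_add, map_add, TensorProduct.map_map, TensorProduct.map_map,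
      TensorProduct.map_map, TensorProduct.map_map, h1, h2, LinearMap.id_comp, LinearMap.comp_id,
      LinearMap.comp_id, LinearMap.id_comp, h3, h3, h4, h4, ih]
  ext1 x
  have e (f : TensorAlgebra K W →ₗ[K] TensorAlgebra K W' ⊗[K] TensorAlgebra K W') :
      map LinearMap.id (aug K W) (map f LinearMap.id (unshuffle 𝒲 x)) = f x ⊗ₜ 1 := by
    have : map f LinearMap.id (map LinearMap.id (aug K W) (unshuffle 𝒲 x)) = f x ⊗ₜ 1 := by
      rw [aug_unshuffle_right]; simp
    rw [← this]
    simp [TensorProduct.map_map]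
  have := congrArg (map LinearMap.id (aug K W)) (LinearMap.congr_fun key x)
  rw [LinearMap.comp_apply, LinearMap.comp_apply, e, e] at this
  simpa using congrArg (TensorProduct.rid K _) this

end Lift

/-! ### Subsets of `{1, …, m+1}` and Koszul signs, according to the last index -/

section Subsets

theorem sum_finset_fin_succ {M : Type*} [AddCommMonoid M] {m : ℕ}
    (g : Finset (Fin (m + 1)) → M) :
    ∑ I, g I = ∑ J : Finset (Fin m), g (J.map Fin.castSuccEmb) +
      ∑ J : Finset (Fin m), g (insert (Fin.last m) (J.map Fin.castSuccEmb)) := by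
  have h : (Finset.univ : Finset (Finset (Fin (m + 1)))) =
      (insert (Fin.last m) (Finset.univ.map Fin.castSuccEmb)).powerset := by
    rw [← Finset.powerset_univ, Fin.univ_castSuccEmb, Finset.cons_eq_insert]
  have h' : (Finset.univ.map (Fin.castSuccEmb (n := m))).powerset =
      Finset.univ.map (Finset.mapEmbedding Fin.castSuccEmb).toEmbedding := by
    ext I
    simp [Finset.subset_map_iff, eq_comm]
  rw [h, Finset.sum_powerset_insert (by simp), h', Finset.sum_map, Finset.sum_map]
  rfl

theorem compl_map_castSucc {m : ℕ} (J : Finset (Fin m)) :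
    (J.map Fin.castSuccEmb)ᶜ = insert (Fin.last m) (Jᶜ.map Fin.castSuccEmb) := by
  ext i
  induction i using Fin.lastCases <;> simp

theorem compl_insert_last {m : ℕ} (J : Finset (Fin m)) :
    (insert (Fin.last m) (J.map Fin.castSuccEmb))ᶜ = Jᶜ.map Fin.castSuccEmb := by
  rw [compl_eq_comm, compl_map_castSucc, compl_compl]

variable {K : Type*} [Field K] {n : ℕ}

/-- Put into the complement, the last index precedes no element of `I`, so it creates no sign. -/
theorem koszulSign_map_castSucc {m : ℕ} (a : Fin (m + 1) → Deg n) (J : Finset (Fin m)) :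
    koszulSign K a (J.map Fin.castSuccEmb) = koszulSign K (fun i => a i.castSucc) J := by
  rw [koszulSign, koszulSign, Finset.prod_map]
  refine Finset.prod_congr rfl fun i _ => ?_
  rw [compl_map_castSucc, Finset.filter_insert, if_neg (by simp [Fin.le_last]), Finset.filter_map,
    Finset.prod_map]
  rfl

/-- The last letter passes every letter of the complement: this is the sign in `leftLetter`. -/
theorem koszulSign_insert_last {m : ℕ} (a : Fin (m + 1) → Deg n) (J : Finset (Fin m)) :
    koszulSign K a (insert (Fin.last m) (J.map Fin.castSuccEmb)) =
      (∏ j ∈ Jᶜ, (-1 : K) ^ pairing (a (Fin.last m)) (a j.castSucc)) *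
        koszulSign K (fun i => a i.castSucc) J := by
  rw [koszulSign, koszulSign, Finset.prod_insert (by simp), compl_insert_last, Finset.prod_map,
    Finset.filter_map, Finset.prod_map]
  congr 1
  · rw [Finset.filter_true_of_mem (by simp [Fin.castSucc_lt_last])]
    simp
  · refine Finset.prod_congr rfl fun i _ => ?_
    rw [Finset.filter_map, Finset.prod_map]
    rfl

end Subsets

/-! ### Comparison of `T(W)` and its coproduct with the tensor algebra -/

section Bridge

open TensorProduct (map)

variable {K : Type*} [Field K] {n : ℕ} {W : Type*} [AddCommGroup W] [Module K W]

theorem tprod_succ {m : ℕ} (v : Fin (m + 1) → W) :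
    TensorAlgebra.tprod K W (m + 1) v =
      TensorAlgebra.tprod K W m (fun i => v i.castSucc) * ι K (v (Fin.last m)) := by
  rw [TensorAlgebra.tprod_apply, TensorAlgebra.tprod_apply, List.ofFn_succ', List.concat_eq_append,
    List.prod_append, List.prod_singleton]

theorem tprod_snoc {m : ℕ} (v : Fin m → W) (w : W) :
    TensorAlgebra.tprod K W (m + 1) (Fin.snoc v w) = TensorAlgebra.tprod K W m v * ι K w := by
  rw [tprod_succ]
  simp only [Fin.snoc_castSucc, Fin.snoc_last]

variable (K) in
/-- The product of the letters `v i`, `i ∈ I`, in natural order. -/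
def subword {m : ℕ} (v : Fin m → W) (I : Finset (Fin m)) : TensorAlgebra K W :=
  (((List.finRange m).filter (· ∈ I)).map fun i => ι K (v i)).prod

theorem subword_map_castSucc {m : ℕ} (v : Fin (m + 1) → W) (J : Finset (Fin m)) :
    subword K v (J.map Fin.castSuccEmb) = subword K (fun i => v i.castSucc) J := by
  simp [subword, List.finRange_succ_last, List.filter_append, List.filter_map, Function.comp_def]

theorem subword_insert_last {m : ℕ} (v : Fin (m + 1) → W) (J : Finset (Fin m)) :
    subword K v (insert (Fin.last m) (J.map Fin.castSuccEmb)) =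
      subword K (fun i => v i.castSucc) J * ι K (v (Fin.last m)) := by
  simp [subword, List.finRange_succ_last, List.filter_append, List.filter_map, Function.comp_def,
    Fin.castSucc_ne_last]

/-- Both sides list `I` increasingly. The list form has no cardinality in its type, so adding a last
index needs no casts. -/
theorem subword_eq_tprod {m : ℕ} (v : Fin m → W) (I : Finset (Fin m)) :
    subword K v I = TensorAlgebra.tprod K W I.card fun i => v (I.orderEmbOfFin rfl i) := by
  have h : (List.finRange m).filter (· ∈ I) = List.ofFn (I.orderEmbOfFin rfl) := by
    refine List.Perm.eq_of_pairwise (le := (· < ·)) ?_ ?_ ?_ ?_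
    · exact fun a b _ _ hab hba => absurd hab hba.not_gt
    · exact (List.pairwise_lt_finRange m).filter _
    · exact List.pairwise_ofFn.2 fun i j hij => (I.orderEmbOfFin rfl).strictMono hij
    · refine (List.perm_ext_iff_of_nodup ((List.nodup_finRange m).filter _)
        (List.nodup_ofFn_ofInjective (I.orderEmbOfFin rfl).injective)).2 fun i => ?_
      have := Set.ext_iff.1 (Finset.range_orderEmbOfFin I rfl) i
      simpa [List.mem_ofFn, -Finset.range_orderEmbOfFin] using this.symm
  rw [subword, TensorAlgebra.tprod_apply, h, List.map_ofFn]
  rfl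

variable (𝒲 : Deg n → Submodule K W)

theorem tprod_mem_algGrading {m : ℕ} (a : Fin m → Deg n) (v : Fin m → W)
    (hv : ∀ i, v i ∈ 𝒲 (a i)) : TensorAlgebra.tprod K W m v ∈ algGrading 𝒲 (∑ i, a i) := by
  induction m with
  | zero => simpa using one_mem_algGrading
  | succ m ih =>
    rw [tprod_succ, Fin.sum_univ_castSucc]
    exact mul_ι_mem_algGrading (ih _ _ fun i => hv _) (hv _)

variable {𝒲} in
theorem HomMonomial.exists_tprod {d : Deg n} {x : TensorAlgebra K W} (hx : HomMonomial 𝒲 d x) :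
    ∃ (p : ℕ) (a : Fin p → Deg n) (v : Fin p → W), (∀ i, v i ∈ 𝒲 (a i)) ∧ ∑ i, a i = d ∧
      x = TensorAlgebra.tprod K W p v := by
  induction hx with
  | one => exact ⟨0, 0, 0, fun i => i.elim0, by simp, by simp⟩
  | @mul d b x w _ hw ih =>
    obtain ⟨p, a, v, hv, rfl, rfl⟩ := ih
    refine ⟨p + 1, Fin.snoc a b, Fin.snoc v w, fun i => ?_, ?_, ?_⟩
    · induction i using Fin.lastCases <;> simp [hw, hv]
    · simp [Fin.sum_univ_castSucc]
    · rw [tprod_snoc]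

variable (K W) in
/-- The inclusion of `T(W)` into the tensor algebra. -/
def toAlg : RedTensor K W →ₗ[K] TensorAlgebra K W :=
  DirectSum.toModule K ℕ _ fun _ => TensorPower.toTensorAlgebra

variable (K W) in
/-- The projection of the tensor algebra to `T(W)`. -/
def ofAlg : TensorAlgebra K W →ₗ[K] RedTensor K W :=
  DirectSum.toModule K ℕ _ (incl K W) ∘ₗ TensorAlgebra.toDirectSum.toLinearMap

theorem ofAlg_tprod {p : ℕ} (v : Fin p → W) :
    ofAlg K W (TensorAlgebra.tprod K W p v) = word K W p v := by
  rw [ofAlg, LinearMap.comp_apply, AlgHom.toLinearMap_apply,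
    TensorAlgebra.toDirectSum_tensorPower_tprod, ← DirectSum.lof_eq_of K, DirectSum.toModule_lof]
  rfl

theorem toAlg_word {m : ℕ} (v : Fin (m + 1) → W) :
    toAlg K W (word K W (m + 1) v) = TensorAlgebra.tprod K W (m + 1) v := by
  simp [toAlg, word, incl, -TensorAlgebra.tprod_apply]

@[simp]
theorem ofAlg_one : ofAlg K W 1 = 0 := by
  have := ofAlg_tprod (K := K) (W := W) (p := 0) Fin.elim0
  simpa [word, incl] using this

theorem redTensor_ext {M : Type*} [AddCommMonoid M] [Module K M] {f g : RedTensor K W →ₗ[K] M}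
    (h : ∀ m v, f (word K W (m + 1) v) = g (word K W (m + 1) v)) : f = g := by
  refine DirectSum.linearMap_ext K fun m => PiTensorProduct.ext ?_
  ext v
  exact h m v

@[simp]
theorem ofAlg_toAlg (x : RedTensor K W) : ofAlg K W (toAlg K W x) = x := by
  suffices h : ofAlg K W ∘ₗ toAlg K W = LinearMap.id from LinearMap.congr_fun h x
  refine redTensor_ext fun m v => ?_
  rw [LinearMap.comp_apply, toAlg_word, ofAlg_tprod, LinearMap.id_apply]

variable {𝒲} in
theorem ofAlg_mem {d : Deg n} {x : TensorAlgebra K W} (hx : x ∈ algGrading 𝒲 d) :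
    ofAlg K W x ∈ tensorGrading 𝒲 d := by
  have h : algGrading 𝒲 d ≤ (tensorGrading 𝒲 d).comap (ofAlg K W) := by
    refine Submodule.span_le.2 fun y hy => ?_
    obtain ⟨p, a, v, hv, ha, rfl⟩ := HomMonomial.exists_tprod hy
    exact Submodule.subset_span ⟨p, a, v, hv, ha, ofAlg_tprod v⟩
  exact h hx

variable {𝒲} in
theorem toAlg_mem {d : Deg n} {x : RedTensor K W} (hx : x ∈ tensorGrading 𝒲 d) :
    toAlg K W x ∈ algGrading 𝒲 d := by
  have h : tensorGrading 𝒲 d ≤ (algGrading 𝒲 d).comap (toAlg K W) := by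
    refine Submodule.span_le.2 ?_
    rintro _ ⟨p, a, v, hv, rfl, rfl⟩
    cases p with
    | zero => simp [word, incl]
    | succ m =>
      simp only [Submodule.comap_coe, Set.mem_preimage, toAlg_word]
      exact tprod_mem_algGrading 𝒲 a v hv
  exact h hx

theorem linearMap_ext_tprod {M : Type*} [AddCommMonoid M] [Module K M]
    {f g : TensorAlgebra K W →ₗ[K] M}
    (h : ∀ (p : ℕ) (v : Fin p → W),
      f (TensorAlgebra.tprod K W p v) = g (TensorAlgebra.tprod K W p v)) : f = g := by
  have e : f ∘ₗ TensorAlgebra.ofDirectSum.toLinearMap =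
      g ∘ₗ TensorAlgebra.ofDirectSum.toLinearMap := by
    refine DirectSum.linearMap_ext K fun m => PiTensorProduct.ext ?_
    ext v
    simpa [DirectSum.lof_eq_of, -TensorAlgebra.tprod_apply] using h m v
  ext x
  simpa using LinearMap.congr_fun e (TensorAlgebra.toDirectSum x)

theorem toAlg_ofAlg_mul_ι (x : TensorAlgebra K W) (w : W) :
    toAlg K W (ofAlg K W (x * ι K w)) = x * ι K w := by
  suffices h : toAlg K W ∘ₗ ofAlg K W ∘ₗ rmul w = rmul w from LinearMap.congr_fun h x
  refine linearMap_ext_tprod fun p v => ?_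
  simp only [LinearMap.comp_apply, rmul_apply]
  rw [← tprod_snoc, ofAlg_tprod, toAlg_word]

theorem pr_ofAlg_mul_ι (x : TensorAlgebra K W) (w : W) :
    pr K W (ofAlg K W (x * ι K w)) = aug K W x • w := by
  suffices h : pr K W ∘ₗ ofAlg K W ∘ₗ rmul w = (aug K W).smulRight w from LinearMap.congr_fun h x
  refine linearMap_ext_tprod fun p v => ?_
  simp only [LinearMap.comp_apply, rmul_apply, LinearMap.smulRight_apply]
  rw [← tprod_snoc, ofAlg_tprod]
  cases p with
  | zero =>
    refine (pr_word_one K W _).trans ?_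
    simp [Fin.snoc]
  | succ m =>
    rw [tprod_succ, aug_mul_ι, zero_smul]
    exact pr_word_add_two K W m _

variable [DirectSum.Decomposition 𝒲]

theorem algSign_subword (d : Deg n) {m : ℕ} (a : Fin m → Deg n) (v : Fin m → W)
    (hv : ∀ i, v i ∈ 𝒲 (a i)) (I : Finset (Fin m)) :
    algSign 𝒲 d (subword K v I) = (∏ i ∈ I, (-1 : K) ^ pairing d (a i)) • subword K v I := by
  have h : ∀ l : List (Fin m), algSign 𝒲 d (l.map fun i => ι K (v i)).prod =
      (l.map fun i => (-1 : K) ^ pairing d (a i)).prod • (l.map fun i => ι K (v i)).prod := by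
    intro l
    induction l with
    | nil => simp
    | cons i l ih =>
      have e : algSign 𝒲 d (ι K (v i)) = (-1 : K) ^ pairing d (a i) • ι K (v i) := by
        simpa using algSign_mul_ι d (hv i) 1
      have e' (x y : TensorAlgebra K W) : algSign 𝒲 d (x * y) = algSign 𝒲 d x * algSign 𝒲 d y := by
        simp [algSign]
      simp only [List.map_cons, List.prod_cons]
      rw [e', e, ih, smul_mul_smul_comm]
  have hI : ((List.finRange m).filter (· ∈ I)).toFinset = I := by ext; simp
  rw [subword, h]
  conv_rhs => rw [← hI]
  rw [List.prod_toFinset _ ((List.nodup_finRange m).filter _), hI]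

theorem unshuffle_tprod {m : ℕ} (a : Fin m → Deg n) (v : Fin m → W) (hv : ∀ i, v i ∈ 𝒲 (a i)) :
    unshuffle 𝒲 (TensorAlgebra.tprod K W m v) =
      ∑ I : Finset (Fin m), koszulSign K a I • (subword K v I ⊗ₜ[K] subword K v Iᶜ) := by
  induction m with
  | zero =>
    rw [Fintype.sum_eq_single ∅ fun I hI => absurd (Subsingleton.elim I ∅) hI]
    simp [koszulSign, subword]
  | succ m ih =>
    -- The subsets with and without the last index give the two terms of `unshuffle_mul_ι`.
    rw [tprod_succ, unshuffle_mul_ι 𝒲 (hv _), ih (fun i => a i.castSucc) _ fun i => hv _,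
      sum_finset_fin_succ, add_comm]
    simp only [map_sum, map_smul, TensorProduct.map_tmul, compl_map_castSucc, compl_insert_last,
      subword_map_castSucc, subword_insert_last, koszulSign_map_castSucc, koszulSign_insert_last,
      algSign_subword 𝒲 _ _ _ fun i => hv i.castSucc, TensorProduct.tmul_smul, smul_smul,
      rmul_apply, LinearMap.id_apply, mul_comm]

theorem linearMap_ext_tprod_homogeneous {M : Type*} [AddCommMonoid M] [Module K M]
    {f g : TensorAlgebra K W →ₗ[K] M}
    (h : ∀ (p : ℕ) (a : Fin p → Deg n) (v : Fin p → W), (∀ i, v i ∈ 𝒲 (a i)) →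
      f (TensorAlgebra.tprod K W p v) = g (TensorAlgebra.tprod K W p v)) : f = g := by
  refine linearMap_ext_homogeneous 𝒲 fun d x hx => ?_
  have : algGrading 𝒲 d ≤ LinearMap.eqLocus f g := by
    refine Submodule.span_le.2 fun y hy => ?_
    obtain ⟨p, a, v, hv, ha, rfl⟩ := HomMonomial.exists_tprod hy
    exact h p a v hv
  exact this hx

/-- The coproduct of `T(W)` in terms of the unshuffle coproduct. -/
theorem coproduct_ofAlg_mul_ι (x : TensorAlgebra K W) {a : Deg n} {w : W} (hw : w ∈ 𝒲 a) :
    coproduct 𝒲 (ofAlg K W (x * ι K w)) =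
      map (ofAlg K W) (ofAlg K W ∘ₗ rmul w) (unshuffle 𝒲 x) := by
  suffices h : coproduct 𝒲 ∘ₗ ofAlg K W ∘ₗ rmul w =
      map (ofAlg K W) (ofAlg K W ∘ₗ rmul w) ∘ₗ unshuffle 𝒲 from LinearMap.congr_fun h x
  refine linearMap_ext_tprod_homogeneous 𝒲 fun m b v hv => ?_
  have hv' : ∀ i, (Fin.snoc v w : Fin (m + 1) → W) i ∈
      𝒲 ((Fin.snoc b a : Fin (m + 1) → Deg n) i) := by
    intro i
    induction i using Fin.lastCases <;> simp [hw, hv]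
  simp only [LinearMap.comp_apply, rmul_apply]
  have hsplit (I : Finset (Fin (m + 1))) : splitWord K W (m + 1) I (Fin.snoc v w) =
      ofAlg K W (subword K (Fin.snoc v w) I) ⊗ₜ[K] ofAlg K W (subword K (Fin.snoc v w) Iᶜ) := by
    rw [splitWord_apply, subword_eq_tprod, subword_eq_tprod, ofAlg_tprod, ofAlg_tprod]
  rw [← tprod_snoc, ofAlg_tprod, coproduct_word 𝒲 m _ _ hv', Finset.sum_filter, sum_finset_fin_succ,
    unshuffle_tprod 𝒲 b v hv, map_sum]
  -- The last letter always stays in the right factor of `Δ`, so half of the subsets drop out.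
  have h0 : ∀ J : Finset (Fin m), (if (insert (Fin.last m) (J.map Fin.castSuccEmb)).Nonempty ∧
      Fin.last m ∉ insert (Fin.last m) (J.map Fin.castSuccEmb) then
      koszulSign K (Fin.snoc b a : Fin (m + 1) → Deg n)
        (insert (Fin.last m) (J.map Fin.castSuccEmb)) •
      splitWord K W (m + 1) (insert (Fin.last m) (J.map Fin.castSuccEmb)) (Fin.snoc v w) else 0)
      = 0 := fun J => if_neg (by simp)
  rw [Finset.sum_congr rfl fun J _ => h0 J, Finset.sum_const_zero, add_zero]
  refine Finset.sum_congr rfl fun J _ => ?_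
  have hlast : Fin.last m ∉ J.map Fin.castSuccEmb := by simp
  rw [hsplit, compl_map_castSucc, subword_map_castSucc, subword_insert_last,
    koszulSign_map_castSucc, map_smul, TensorProduct.map_tmul]
  simp only [hlast, Finset.map_nonempty, not_false_eq_true, and_true, Fin.snoc_castSucc,
    Fin.snoc_last, LinearMap.comp_apply, rmul_apply]
  split_ifs with hJ
  · rfl
  -- The empty subset, excluded from `Δ`, gives the left factor `1`, which `ofAlg` sends to `0`.
  · rw [Finset.not_nonempty_iff_eq_empty.1 hJ]
    simp [subword]

end Bridge

/-! ### Cohomomorphisms of `T(W)` and their corestrictions -/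

section Transfer

open TensorProduct (map)

variable {K : Type*} [Field K] {n : ℕ} {W : Type*} [AddCommGroup W] [Module K W]
  (𝒲 : Deg n → Submodule K W) [DirectSum.Decomposition 𝒲]
  {W' : Type*} [AddCommGroup W'] [Module K W']
  (𝒲' : Deg n → Submodule K W') [DirectSum.Decomposition 𝒲']

/-- Homogeneity of `w` is removed by linearity, for use with letters `φ(zw)` in
`coproduct_ofAlg_attach`. -/
theorem coproduct_ofAlg_comp_rmul (w : W) : coproduct 𝒲 ∘ₗ ofAlg K W ∘ₗ rmul w =
    map (ofAlg K W) (ofAlg K W ∘ₗ rmul w) ∘ₗ unshuffle 𝒲 := by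
  have hw : w ∈ Submodule.span K {w | ∃ a, w ∈ 𝒲 a} := by
    rw [span_homogeneous]; trivial
  induction hw using Submodule.span_induction with
  | mem w hw => exact hw.elim fun a hw => LinearMap.ext fun x => coproduct_ofAlg_mul_ι 𝒲 x hw
  | zero => simp [← rmulₗ_apply]
  | add u v _ _ hu hv =>
    simp only [← rmulₗ_apply] at hu hv
    simp only [← rmulₗ_apply, map_add, LinearMap.comp_add, TensorProduct.map_add_right,
      LinearMap.add_comp, hu, hv]
  | smul c u _ hu =>
    simp only [← rmulₗ_apply] at hu
    simp only [← rmulₗ_apply, map_smul, LinearMap.comp_smul, TensorProduct.map_smul_right,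
      LinearMap.smul_comp, hu]

theorem toAlg_ofAlg_add (x : TensorAlgebra K W) :
    toAlg K W (ofAlg K W x) + aug K W x • 1 = x := by
  suffices h : toAlg K W ∘ₗ ofAlg K W + (aug K W).smulRight 1 = LinearMap.id from
    LinearMap.congr_fun h x
  refine linearMap_ext_tprod fun p v => ?_
  cases p with
  | zero => simp
  | succ m =>
    rw [tprod_succ]
    simp only [LinearMap.add_apply, LinearMap.comp_apply, LinearMap.smulRight_apply, aug_mul_ι,
      zero_smul, add_zero, LinearMap.id_apply, toAlg_ofAlg_mul_ι]

theorem aug_toAlg (z : RedTensor K W) : aug K W (toAlg K W z) = 0 := by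
  suffices h : aug K W ∘ₗ toAlg K W = 0 from LinearMap.congr_fun h z
  refine redTensor_ext fun m v => ?_
  rw [LinearMap.comp_apply, toAlg_word, tprod_succ, aug_mul_ι, LinearMap.zero_apply]

theorem redTensor_ext_homogeneous {M : Type*} [AddCommMonoid M] [Module K M]
    {f g : RedTensor K W →ₗ[K] M}
    (h : ∀ (x : TensorAlgebra K W) (a : Deg n), ∀ w ∈ 𝒲 a,
      f (ofAlg K W (x * ι K w)) = g (ofAlg K W (x * ι K w))) : f = g := by
  have e : f ∘ₗ ofAlg K W = g ∘ₗ ofAlg K W :=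
    linearMap_ext 𝒲 (by simp) fun x a w hw _ => h x a w hw
  refine LinearMap.ext fun z => ?_
  simpa using LinearMap.congr_fun e (toAlg K W z)

/-- A word is its last letter or a product of a shorter word with its last letter. -/
theorem toAlg_eq (z : RedTensor K W) : toAlg K W z = ι K (pr K W z) +
    TensorProduct.lift (rmulₗ K W).flip (map (toAlg K W) (pr K W) (coproduct 𝒲 z)) := by
  suffices h : toAlg K W = ι K ∘ₗ pr K W +
      TensorProduct.lift (rmulₗ K W).flip ∘ₗ map (toAlg K W) (pr K W) ∘ₗ coproduct 𝒲 from
    LinearMap.congr_fun h z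
  refine redTensor_ext_homogeneous 𝒲 fun x a w hw => ?_
  -- Only terms whose right factor is the single letter `w` survive `pr`; by the counit, this leaves
  -- all of `x` on the left.
  have hpr : pr K W ∘ₗ ofAlg K W ∘ₗ rmul w = LinearMap.toSpanSingleton K W w ∘ₗ aug K W :=
    LinearMap.ext fun x => pr_ofAlg_mul_ι x w
  have e : map (toAlg K W ∘ₗ ofAlg K W) (pr K W ∘ₗ ofAlg K W ∘ₗ rmul w) (unshuffle 𝒲 x) =
      map (toAlg K W ∘ₗ ofAlg K W) (LinearMap.toSpanSingleton K W w)
        (map LinearMap.id (aug K W) (unshuffle 𝒲 x)) := by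
    rw [hpr, TensorProduct.map_map, LinearMap.comp_id]
  simp only [LinearMap.add_apply, LinearMap.comp_apply]
  rw [coproduct_ofAlg_mul_ι 𝒲 x hw, TensorProduct.map_map, e, aug_unshuffle_right,
    toAlg_ofAlg_mul_ι, pr_ofAlg_mul_ι]
  conv_lhs => rw [← toAlg_ofAlg_add x]
  simp [add_mul, add_comm]

variable {𝒲 𝒲'}

/-- The extension of a cohomomorphism to the full tensor algebras. -/
def Cohom.extend (F : Cohom 𝒲 𝒲') : TensorAlgebra K W →ₗ[K] TensorAlgebra K W' :=
  toAlg K W' ∘ₗ F.toLin ∘ₗ ofAlg K W + (aug K W).smulRight 1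

theorem Cohom.extend_eq (F : Cohom 𝒲 𝒲') :
    F.extend = cohomLift 𝒲 (pr K W' ∘ₗ F.toLin ∘ₗ ofAlg K W) := by
  refine eq_cohomLift 𝒲 (by simp [Cohom.extend]) fun a w hw x => ?_
  set φ := pr K W' ∘ₗ F.toLin ∘ₗ ofAlg K W with hφ
  have h1 : coproduct 𝒲' (F.toLin (ofAlg K W (x * ι K w))) =
      map (F.toLin ∘ₗ ofAlg K W) (F.toLin ∘ₗ ofAlg K W ∘ₗ rmul w) (unshuffle 𝒲 x) := by
    have := LinearMap.congr_fun F.comul (ofAlg K W (x * ι K w))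
    simp only [LinearMap.comp_apply] at this
    rw [this, coproduct_ofAlg_mul_ι 𝒲 x hw, TensorProduct.map_map]
  -- The value `1` at `1` accounts for the term with `x₁ = 1`; it matches the single-letter part in
  -- `toAlg_eq`.
  have h2 : map ((aug K W).smulRight (1 : TensorAlgebra K W')) (φ ∘ₗ rmul w) (unshuffle 𝒲 x) =
      1 ⊗ₜ φ (x * ι K w) := by
    have e : map ((aug K W).smulRight (1 : TensorAlgebra K W')) (φ ∘ₗ rmul w) (unshuffle 𝒲 x) =
        map (LinearMap.toSpanSingleton K _ (1 : TensorAlgebra K W')) (φ ∘ₗ rmul w)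
          (map (aug K W) LinearMap.id (unshuffle 𝒲 x)) := by
      rw [TensorProduct.map_map, LinearMap.comp_id]; rfl
    rw [e, aug_unshuffle_left]
    simp
  have h3 : attach φ w (map F.extend LinearMap.id (unshuffle 𝒲 x)) =
      TensorProduct.lift (rmulₗ K W').flip (map F.extend (φ ∘ₗ rmul w) (unshuffle 𝒲 x)) := by
    change TensorProduct.lift (rmulₗ K W').flip (map LinearMap.id (φ ∘ₗ rmul w) _) = _
    rw [TensorProduct.map_map, LinearMap.comp_id, LinearMap.id_comp]
  rw [h3, Cohom.extend, TensorProduct.map_add_left,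
    LinearMap.add_apply (map _ _) (map _ _) (unshuffle 𝒲 x), map_add, h2]
  simp only [LinearMap.add_apply, LinearMap.comp_apply, LinearMap.smulRight_apply, aug_mul_ι,
    zero_smul, add_zero]
  rw [toAlg_eq 𝒲', h1, TensorProduct.map_map, add_comm]
  simp [hφ, LinearMap.comp_assoc]

theorem Cohom.ofAlg_extend (F : Cohom 𝒲 𝒲') (x : TensorAlgebra K W) :
    ofAlg K W' (F.extend x) = F.toLin (ofAlg K W x) := by
  simp [Cohom.extend]

theorem Cohom.extend_toAlg (F : Cohom 𝒲 𝒲') (z : RedTensor K W) :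
    F.extend (toAlg K W z) = toAlg K W' (F.toLin z) := by
  simp [Cohom.extend, aug_toAlg]

/-- A cohomomorphism is determined by its corestriction. -/
theorem Cohom.ext_pr {F G : Cohom 𝒲 𝒲'} (h : pr K W' ∘ₗ F.toLin = pr K W' ∘ₗ G.toLin) : F = G := by
  have e : F.extend = G.extend := by
    rw [F.extend_eq, G.extend_eq, ← LinearMap.comp_assoc, h, LinearMap.comp_assoc]
  refine Cohom.ext (LinearMap.ext fun z => ?_)
  rw [← ofAlg_toAlg z, ← F.ofAlg_extend, e, G.ofAlg_extend]

theorem coproduct_ofAlg_attach (φ : TensorAlgebra K W →ₗ[K] W') (w : W) :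
    coproduct 𝒲' ∘ₗ ofAlg K W' ∘ₗ attach φ w =
      map (ofAlg K W') (ofAlg K W' ∘ₗ attach φ w) ∘ₗ
        (TensorProduct.assoc K _ _ _).toLinearMap ∘ₗ map (unshuffle 𝒲') LinearMap.id := by
  refine TensorProduct.ext' fun y z => ?_
  have h := LinearMap.congr_fun (coproduct_ofAlg_comp_rmul 𝒲' (φ (z * ι K w))) y
  simp only [LinearMap.comp_apply, rmul_apply] at h
  simp only [LinearMap.comp_apply, attach_tmul, TensorProduct.map_tmul, LinearEquiv.coe_coe,
    LinearMap.id_apply, h]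
  induction unshuffle 𝒲' y using TensorProduct.induction_on with
  | zero => simp
  | tmul p q => simp
  | add s t hs ht => simp only [map_add, TensorProduct.add_tmul, hs, ht]

theorem ofAlg_cohomLift (φ : TensorAlgebra K W →ₗ[K] W') (x : TensorAlgebra K W) :
    ofAlg K W' (cohomLift 𝒲 φ (toAlg K W (ofAlg K W x))) = ofAlg K W' (cohomLift 𝒲 φ x) := by
  conv_rhs => rw [← toAlg_ofAlg_add x]
  simp

/-- The cohomomorphism with given corestriction. -/
def Cohom.ofCorestriction (φ : RedTensor K W →ₗ[K] W')
    (hφ : ∀ d, ∀ x ∈ tensorGrading 𝒲 d, φ x ∈ 𝒲' d) : Cohom 𝒲 𝒲' where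
  toLin := ofAlg K W' ∘ₗ cohomLift 𝒲 (φ ∘ₗ ofAlg K W) ∘ₗ toAlg K W
  weight d x hx := ofAlg_mem (cohomLift_mem (fun d x hx => hφ d _ (ofAlg_mem hx)) (toAlg_mem hx))
  comul := by
    refine redTensor_ext_homogeneous 𝒲 fun x a w hw => ?_
    set ψ := φ ∘ₗ ofAlg K W
    set F := cohomLift 𝒲 ψ with hFdef
    have hψ : ∀ d, ∀ x ∈ algGrading 𝒲 d, ψ x ∈ 𝒲' d := fun d x hx => hφ d _ (ofAlg_mem hx)
    have h1 : (ofAlg K W' ∘ₗ F ∘ₗ toAlg K W) ∘ₗ ofAlg K W = ofAlg K W' ∘ₗ F :=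
      LinearMap.ext fun x => ofAlg_cohomLift ψ x
    have hF : F ∘ₗ rmul w = (attach ψ w ∘ₗ map F LinearMap.id) ∘ₗ unshuffle 𝒲 :=
      LinearMap.ext fun x => cohomLift_mul_ι 𝒲 ψ hw x
    -- Together with coassociativity, this turns `Δ(∑ F(x₁) φ(x₂w))` into `∑ F(x₁) ⊗ F(x₂) φ(x₃w) =
    -- ∑ F(x₁) ⊗ F(x₂w)`.
    have h2 : TensorProduct.assoc K _ _ _ (map (unshuffle 𝒲') LinearMap.id
        (map F LinearMap.id (unshuffle 𝒲 x))) =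
        map F (map F LinearMap.id ∘ₗ unshuffle 𝒲) (unshuffle 𝒲 x) := by
      have e1 : map (unshuffle 𝒲') LinearMap.id (map F LinearMap.id (unshuffle 𝒲 x)) =
          map (map F F) LinearMap.id (map (unshuffle 𝒲) LinearMap.id (unshuffle 𝒲 x)) := by
        rw [TensorProduct.map_map, TensorProduct.map_map, hFdef, unshuffle_comp_cohomLift 𝒲' hψ]
      rw [e1, ← TensorProduct.map_map_assoc, unshuffle_coassoc, TensorProduct.map_map,
        LinearMap.comp_id]
    have h3 := LinearMap.congr_fun (coproduct_ofAlg_attach (𝒲' := 𝒲') ψ w)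
      (map F LinearMap.id (unshuffle 𝒲 x))
    simp only [LinearMap.comp_apply, LinearEquiv.coe_coe] at h3
    simp only [LinearMap.comp_apply]
    rw [toAlg_ofAlg_mul_ι, coproduct_ofAlg_mul_ι 𝒲 x hw, TensorProduct.map_map,
      ← LinearMap.comp_assoc _ (ofAlg K W), h1, LinearMap.comp_assoc, hF, hFdef,
      cohomLift_mul_ι 𝒲 ψ hw, ← hFdef, h3, h2, TensorProduct.map_map]
    simp only [LinearMap.comp_assoc]

theorem Cohom.pr_ofCorestriction (φ : RedTensor K W →ₗ[K] W')
    (hφ : ∀ d, ∀ x ∈ tensorGrading 𝒲 d, φ x ∈ 𝒲' d) :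
    pr K W' ∘ₗ (Cohom.ofCorestriction φ hφ : Cohom 𝒲 𝒲').toLin = φ := by
  refine redTensor_ext_homogeneous 𝒲 fun x a w hw => ?_
  -- Projecting `∑ F(x₁) φ(x₂w)` to single letters applies the augmentation to `F(x₁)`, so that the
  -- counit leaves `φ(xw)`.
  have h : ∀ t, pr K W' (ofAlg K W' (attach (φ ∘ₗ ofAlg K W) w t)) =
      TensorProduct.lid K W' (map (aug K W') (φ ∘ₗ ofAlg K W ∘ₗ rmul w) t) := by
    intro t
    induction t using TensorProduct.induction_on with
    | zero => simp
    | add s t hs ht => simp only [map_add, hs, ht]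
    | tmul y z => simp [pr_ofAlg_mul_ι]
  have e : map (aug K W) (φ ∘ₗ ofAlg K W ∘ₗ rmul w) (unshuffle 𝒲 x) =
      map LinearMap.id (φ ∘ₗ ofAlg K W ∘ₗ rmul w)
        (map (aug K W) LinearMap.id (unshuffle 𝒲 x)) := by
    rw [TensorProduct.map_map, LinearMap.comp_id, LinearMap.id_comp]
  simp only [Cohom.ofCorestriction, LinearMap.comp_apply]
  rw [toAlg_ofAlg_mul_ι, cohomLift_mul_ι 𝒲 _ hw, h, TensorProduct.map_map, aug_comp_cohomLift,
    LinearMap.comp_id, e, aug_unshuffle_left]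
  simp

end Transfer

/-! ### The length filtration and bijectivity -/

section Length

open TensorProduct (map)

variable {K : Type*} [Field K] {n : ℕ} {W : Type*} [AddCommGroup W] [Module K W]
  (𝒲 : Deg n → Submodule K W)
  {W' : Type*} [AddCommGroup W'] [Module K W'] (𝒲' : Deg n → Submodule K W')

/-- The span of the words of length less than `p`. -/
def shortWords : ℕ → Submodule K (TensorAlgebra K W)
  | 0 => ⊥
  | p + 1 => Submodule.span K ({1} ∪ {y | ∃ x ∈ shortWords p, ∃ a, ∃ w ∈ 𝒲 a, y = x * ι K w})

variable {𝒲}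

theorem one_mem_shortWords (p : ℕ) : (1 : TensorAlgebra K W) ∈ shortWords 𝒲 (p + 1) :=
  Submodule.subset_span (Or.inl rfl)

theorem shortWords_succ_le {p : ℕ} {P : Submodule K (TensorAlgebra K W)} (h1 : 1 ∈ P)
    (hmul : ∀ x ∈ shortWords 𝒲 p, ∀ a, ∀ w ∈ 𝒲 a, x * ι K w ∈ P) :
    shortWords 𝒲 (p + 1) ≤ P := by
  refine Submodule.span_le.2 ?_
  rintro _ (rfl | ⟨x, hx, a, w, hw, rfl⟩)
  exacts [h1, hmul x hx a w hw]

theorem shortWords_le_succ (p : ℕ) : shortWords 𝒲 p ≤ shortWords 𝒲 (p + 1) := by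
  induction p with
  | zero => exact bot_le
  | succ p ih =>
    exact shortWords_succ_le (one_mem_shortWords _) fun x hx a w hw =>
      Submodule.subset_span (Or.inr ⟨x, ih hx, a, w, hw, rfl⟩)

/-- The span of the tensors `y ⊗ z`, where `y` has length less than `p`. -/
def shortLeft (𝒲 : Deg n → Submodule K W) (p : ℕ) :
    Submodule K (TensorAlgebra K W ⊗[K] TensorAlgebra K W) :=
  Submodule.span K {t | ∃ y ∈ shortWords 𝒲 p, ∃ z, t = y ⊗ₜ z}

theorem tmul_mem_shortLeft {p : ℕ} {y : TensorAlgebra K W} (hy : y ∈ shortWords 𝒲 p)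
    (z : TensorAlgebra K W) : y ⊗ₜ z ∈ shortLeft 𝒲 p :=
  Submodule.subset_span ⟨y, hy, z, rfl⟩

theorem shortLeft_le_comap {M : Type*} [AddCommMonoid M] [Module K M] {p : ℕ}
    {f : TensorAlgebra K W ⊗[K] TensorAlgebra K W →ₗ[K] M} {P : Submodule K M}
    (h : ∀ y ∈ shortWords 𝒲 p, ∀ z, f (y ⊗ₜ z) ∈ P) : shortLeft 𝒲 p ≤ P.comap f := by
  refine Submodule.span_le.2 ?_
  rintro _ ⟨y, hy, z, rfl⟩
  exact h y hy z

/-- The algebra morphism induced by a linear map. -/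
def algMap (g : W →ₗ[K] W') : TensorAlgebra K W →ₐ[K] TensorAlgebra K W' :=
  TensorAlgebra.lift K (ι K ∘ₗ g)

@[simp]
theorem algMap_ι (g : W →ₗ[K] W') (w : W) : algMap g (ι K w) = ι K (g w) := by simp [algMap]

theorem algMap_algMap {g : W →ₗ[K] W'} {h : W' →ₗ[K] W} (hg : ∀ w, h (g w) = w)
    (x : TensorAlgebra K W) : algMap h (algMap g x) = x := by
  have e : (algMap h).comp (algMap g) = AlgHom.id K _ := by
    ext w
    simp [hg]
  exact AlgHom.congr_fun e x

variable {𝒲'}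

theorem algMap_mem_algGrading {g : W →ₗ[K] W'} (hg : ∀ a, ∀ w ∈ 𝒲 a, g w ∈ 𝒲' a) {d : Deg n}
    {x : TensorAlgebra K W} (hx : x ∈ algGrading 𝒲 d) : algMap g x ∈ algGrading 𝒲' d := by
  refine map_mem_of_monomial (f := (algMap g).toLinearMap) (P := algGrading 𝒲') ?_
    (fun d a x w hw ih => ?_) hx
  · simpa using one_mem_algGrading
  · simpa using mul_ι_mem_algGrading ih (hg a w hw)

theorem pr_mem {d : Deg n} {x : RedTensor K W} (hx : x ∈ tensorGrading 𝒲 d) :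
    pr K W x ∈ 𝒲 d := by
  have h : tensorGrading 𝒲 d ≤ (𝒲 d).comap (pr K W) := by
    refine Submodule.span_le.2 ?_
    rintro _ ⟨p, a, v, hv, rfl, rfl⟩
    match p with
    | 0 => simp [word, incl]
    | 1 => simpa [pr_word_one] using hv 0
    | m + 2 => simp [pr_word_add_two]
  exact h hx

variable [DirectSum.Decomposition 𝒲]

theorem mul_ι_mem_shortWords {p : ℕ} {x : TensorAlgebra K W} (hx : x ∈ shortWords 𝒲 p) (w : W) :
    x * ι K w ∈ shortWords 𝒲 (p + 1) := by
  have hw : w ∈ Submodule.span K {w | ∃ a, w ∈ 𝒲 a} := by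
    rw [span_homogeneous]; trivial
  induction hw using Submodule.span_induction with
  | mem w hw => exact hw.elim fun a hw => Submodule.subset_span (Or.inr ⟨x, hx, a, w, hw, rfl⟩)
  | zero => simp
  | add u v _ _ hu hv => rw [map_add, mul_add]; exact add_mem hu hv
  | smul c u _ hu => rw [map_smul, mul_smul_comm]; exact Submodule.smul_mem _ c hu

theorem algMap_mem_shortWords {U : Type*} [AddCommGroup U] [Module K U]
    {𝒰 : Deg n → Submodule K U} (g : U →ₗ[K] W) {p : ℕ} {x : TensorAlgebra K U}
    (hx : x ∈ shortWords 𝒰 p) : algMap g x ∈ shortWords 𝒲 p := by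
  induction p generalizing x with
  | zero =>
    obtain rfl : x = 0 := hx
    simp
  | succ p ih =>
    refine shortWords_succ_le (P := (shortWords 𝒲 (p + 1)).comap (algMap g).toLinearMap) ?_
      (fun x hx a w hw => ?_) hx
    · simpa using one_mem_shortWords p
    · simpa using mul_ι_mem_shortWords (ih hx) (g w)

variable (𝒲) in
theorem exists_mem_shortWords (x : TensorAlgebra K W) : ∃ p, x ∈ shortWords 𝒲 p := by
  have hmono : Monotone (shortWords 𝒲) := monotone_nat_of_le_succ shortWords_le_succ
  have h : ⨆ p, shortWords 𝒲 p = ⊤ := by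
    refine right_induction 𝒲 _ (Submodule.mem_iSup_of_mem 1 (one_mem_shortWords 0))
      fun x hx a w hw => ?_
    obtain ⟨p, hp⟩ := (Submodule.mem_iSup_of_directed _ hmono.directed_le).1 hx
    exact Submodule.mem_iSup_of_mem (p + 1) (mul_ι_mem_shortWords hp w)
  exact (Submodule.mem_iSup_of_directed _ hmono.directed_le).1 (h ▸ Submodule.mem_top)

/-- Only `x ⊗ 1` has all letters on the left; every other term has a strictly shorter left factor.
-/
theorem unshuffle_sub_mem {p : ℕ} {x : TensorAlgebra K W} (hx : x ∈ shortWords 𝒲 (p + 1)) :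
    unshuffle 𝒲 x - x ⊗ₜ 1 ∈ shortLeft 𝒲 p := by
  induction p generalizing x with
  | zero =>
    refine shortWords_succ_le (P := (shortLeft 𝒲 0).comap
      (unshuffle 𝒲 - (TensorProduct.mk K _ _).flip 1)) ?_ (fun x hx a w hw => ?_) hx
    · simp
    · obtain rfl : x = 0 := hx
      simp
  | succ p ih =>
    refine shortWords_succ_le (P := (shortLeft 𝒲 (p + 1)).comap
      (unshuffle 𝒲 - (TensorProduct.mk K _ _).flip 1)) ?_ (fun x hx a w hw => ?_) hx
    · simp
    · have h1 := shortLeft_le_comap (f := map (rmul w) (algSign 𝒲 a)) (P := shortLeft 𝒲 (p + 1))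
        (fun y hy z => tmul_mem_shortLeft (mul_ι_mem_shortWords hy w) _) (ih hx)
      have h2 := shortLeft_le_comap (f := map LinearMap.id (rmul w)) (P := shortLeft 𝒲 (p + 1))
        (fun y hy z => tmul_mem_shortLeft (shortWords_le_succ p hy) _) (ih hx)
      -- Appending `w` to the right factor of `x ⊗ 1` gives a new term, whose left factor `x` is
      -- shorter than `xw`.
      have h3 : x ⊗ₜ (1 * ι K w) ∈ shortLeft 𝒲 (p + 1) := tmul_mem_shortLeft hx _
      rw [Submodule.mem_comap]
      convert add_mem (add_mem (Submodule.mem_comap.1 h1) (Submodule.mem_comap.1 h2)) h3 using 1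
      simp only [LinearMap.sub_apply, LinearMap.flip_apply, TensorProduct.mk_apply,
        unshuffle_mul_ι 𝒲 hw, map_sub, TensorProduct.map_tmul, rmul_apply, algSign_one,
        LinearMap.id_apply]
      abel

variable [DirectSum.Decomposition 𝒲']

variable {φ : TensorAlgebra K W →ₗ[K] W'}

/-- Up to shorter words, `cohomLift` is induced by the linear part of the corestriction. -/
theorem cohomLift_sub_algMap_mem {p : ℕ} {x : TensorAlgebra K W}
    (hx : x ∈ shortWords 𝒲 (p + 1)) :
    cohomLift 𝒲 φ x - algMap (φ ∘ₗ ι K) x ∈ shortWords 𝒲' p := by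
  induction p generalizing x with
  | zero =>
    refine shortWords_succ_le (P := (shortWords 𝒲' 0).comap
      (cohomLift 𝒲 φ - (algMap (φ ∘ₗ ι K)).toLinearMap)) ?_ (fun x hx a w hw => ?_) hx
    · simp
    · obtain rfl : x = 0 := hx
      simp
  | succ p ih =>
    have ih' : ∀ y ∈ shortWords 𝒲 p, cohomLift 𝒲 φ y ∈ shortWords 𝒲' p := fun y hy => by
      have := add_mem (ih (shortWords_le_succ p hy)) (algMap_mem_shortWords (𝒲 := 𝒲') (φ ∘ₗ ι K) hy)
      simpa using this
    refine shortWords_succ_le (P := (shortWords 𝒲' (p + 1)).comap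
      (cohomLift 𝒲 φ - (algMap (φ ∘ₗ ι K)).toLinearMap)) ?_ (fun x hx a w hw => ?_) hx
    · simp
    -- The terms of the recursion other than `x ⊗ 1` lose length, because `F` does not lengthen
    -- words (`ih'`); the term of `x ⊗ 1` is `F(x) φ(w)`, treated in `h2`.
    · have h1 := shortLeft_le_comap (f := attach φ w ∘ₗ map (cohomLift 𝒲 φ) LinearMap.id)
        (P := shortWords 𝒲' (p + 1))
        (fun y hy z => by simpa using mul_ι_mem_shortWords (ih' y hy) _) (unshuffle_sub_mem hx)
      have h2 := mul_ι_mem_shortWords (ih hx) (φ (ι K w))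
      rw [Submodule.mem_comap]
      convert add_mem (Submodule.mem_comap.1 h1) h2 using 1
      simp [cohomLift_mul_ι 𝒲 φ hw, sub_mul]

theorem apply_decompose {g : W →ₗ[K] W'} (hg : ∀ a, ∀ w ∈ 𝒲 a, g w ∈ 𝒲' a) (w : W) (a : Deg n) :
    g (DirectSum.decompose 𝒲 w a) = DirectSum.decompose 𝒲' (g w) a := by
  induction w using DirectSum.Decomposition.inductionOn 𝒲 with
  | zero => simp
  | add u v hu hv => simp [hu, hv]
  | @homogeneous b w =>
    by_cases h : b = a
    · subst h
      rw [DirectSum.decompose_of_mem_same _ w.2, DirectSum.decompose_of_mem_same _ (hg _ _ w.2)]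
    · rw [DirectSum.decompose_of_mem_ne _ w.2 h, DirectSum.decompose_of_mem_ne _ (hg _ _ w.2) h,
        map_zero]

/-- An injective graded map commutes with homogeneous components, hence reflects degrees; so the
inverse of the linear part has weight `0`. -/
theorem mem_of_apply_mem {g : W →ₗ[K] W'} (hg : ∀ a, ∀ w ∈ 𝒲 a, g w ∈ 𝒲' a)
    (hinj : Function.Injective g) {a : Deg n} {w : W} (hw : g w ∈ 𝒲' a) : w ∈ 𝒲 a := by
  have : g (DirectSum.decompose 𝒲 w a) = g w := by
    rw [apply_decompose hg, DirectSum.decompose_of_mem_same _ hw]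
  rw [← hinj this]
  exact SetLike.coe_mem _

variable (𝒲 𝒲') in
-- With `L` the algebra morphism inverse to the linear part, `L ∘ F - id` lowers length, and every
-- element has finite length. Surjectivity is stated degree by degree so that the inverse has weight
-- `0`.
theorem cohomLift_bijective_graded (hφ : ∀ d, ∀ x ∈ algGrading 𝒲 d, φ x ∈ 𝒲' d)
    (hbij : Function.Bijective (φ ∘ₗ ι K)) : Function.Injective (cohomLift 𝒲 φ) ∧
      ∀ d, ∀ y ∈ algGrading 𝒲' d, ∃ x ∈ algGrading 𝒲 d, cohomLift 𝒲 φ x = y := by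
  set g : W ≃ₗ[K] W' := LinearEquiv.ofBijective (φ ∘ₗ ι K) hbij
  have hg : ∀ a, ∀ w ∈ 𝒲 a, g w ∈ 𝒲' a := fun a w hw => by
    have := mul_ι_mem_algGrading (one_mem_algGrading (𝒲 := 𝒲)) hw
    rw [zero_add, one_mul] at this
    exact hφ a _ this
  have hg' : ∀ a, ∀ w ∈ 𝒲' a, g.symm.toLinearMap w ∈ 𝒲 a := fun a w hw =>
    mem_of_apply_mem (g := g.toLinearMap) hg g.injective (by simpa using hw)
  set L := algMap (K := K) g.symm.toLinearMap
  have hL (x : TensorAlgebra K W) : L (algMap (φ ∘ₗ ι K) x) = x :=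
    algMap_algMap (fun w => g.symm_apply_apply w) x
  have hL' (y : TensorAlgebra K W') : algMap g.toLinearMap (L y) = y :=
    algMap_algMap (fun w => g.apply_symm_apply w) y
  have key : ∀ p, ∀ x ∈ shortWords 𝒲 (p + 1), L (cohomLift 𝒲 φ x) - x ∈ shortWords 𝒲 p := by
    intro p x hx
    have := algMap_mem_shortWords (𝒲 := 𝒲) g.symm.toLinearMap
      (cohomLift_sub_algMap_mem (𝒲' := 𝒲') (φ := φ) hx)
    rwa [map_sub, hL] at this
  constructor
  · rw [← LinearMap.ker_eq_bot, LinearMap.ker_eq_bot']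
    intro x hx
    obtain ⟨p, hp⟩ := exists_mem_shortWords 𝒲 x
    induction p with
    | zero => exact hp
    | succ p ih =>
      have := key p x hp
      rw [hx, map_zero, zero_sub, neg_mem_iff] at this
      exact ih this
  · have surj : ∀ p, ∀ d, ∀ y ∈ algGrading 𝒲 d, y ∈ shortWords 𝒲 p →
        ∃ x ∈ algGrading 𝒲 d, L (cohomLift 𝒲 φ x) = y := by
      intro p
      induction p with
      | zero =>
        intro d y _ hy
        obtain rfl : y = 0 := hy
        exact ⟨0, zero_mem _, by simp⟩
      | succ p ih =>
        intro d y hy hyp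
        obtain ⟨x, hx, hxy⟩ := ih d (L (cohomLift 𝒲 φ y) - y)
          (sub_mem (algMap_mem_algGrading hg' (cohomLift_mem hφ hy)) hy) (key p y hyp)
        -- The error `L(F(y)) - y` is shorter and of the same degree; subtracting its preimage `x`
        -- corrects `y`.
        exact ⟨y - x, sub_mem hy hx, by rw [map_sub, map_sub, hxy]; abel⟩
    intro d y hy
    obtain ⟨p, hp⟩ := exists_mem_shortWords 𝒲 (L y)
    obtain ⟨x, hx, hxy⟩ := surj p d (L y) (algMap_mem_algGrading hg' hy) hp
    exact ⟨x, hx, by rw [← hL' (cohomLift 𝒲 φ x), hxy, hL']⟩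

end Length

/-! ### Inverse cohomomorphisms -/

section Inverse

variable {K : Type*} [Field K] {n : ℕ} {W : Type*} [AddCommGroup W] [Module K W]
  {𝒲 : Deg n → Submodule K W} [DirectSum.Decomposition 𝒲]
  {W' : Type*} [AddCommGroup W'] [Module K W']
  {𝒲' : Deg n → Submodule K W'} [DirectSum.Decomposition 𝒲']

theorem ofAlg_ι (w : W) : ofAlg K W (ι K w) = word K W 1 fun _ => w := by
  rw [← ofAlg_tprod]
  simp

theorem span_tensorGrading (𝒲 : Deg n → Submodule K W) [DirectSum.Decomposition 𝒲] :
    Submodule.span K {x | ∃ d, x ∈ tensorGrading 𝒲 d} = ⊤ := by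
  have h : (⊤ : Submodule K (TensorAlgebra K W)) ≤
      (Submodule.span K {x | ∃ d, x ∈ tensorGrading 𝒲 d}).comap (ofAlg K W) := by
    rw [← span_algGrading 𝒲]
    exact Submodule.span_le.2 fun x ⟨d, hx⟩ => Submodule.subset_span ⟨d, ofAlg_mem hx⟩
  rw [eq_top_iff]
  intro z _
  simpa using h (Submodule.mem_top (x := toAlg K W z))

theorem Cohom.bijective_graded (F : Cohom 𝒲 𝒲')
    (hF : Function.Bijective fun w => pr K W' (F.toLin (word K W 1 fun _ => w))) :
    Function.Injective F.toLin ∧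
      ∀ d, ∀ y ∈ tensorGrading 𝒲' d, ∃ x ∈ tensorGrading 𝒲 d, F.toLin x = y := by
  have hφ : ∀ d, ∀ x ∈ algGrading 𝒲 d, (pr K W' ∘ₗ F.toLin ∘ₗ ofAlg K W) x ∈ 𝒲' d :=
    fun d x hx => pr_mem (F.weight d _ (ofAlg_mem hx))
  have hbij : Function.Bijective ((pr K W' ∘ₗ F.toLin ∘ₗ ofAlg K W) ∘ₗ ι K) := by
    simpa [Function.Bijective, Function.Injective, Function.Surjective, ofAlg_ι] using hF
  obtain ⟨hinj, hsurj⟩ := cohomLift_bijective_graded 𝒲 𝒲' hφ hbij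
  rw [← F.extend_eq] at hinj hsurj
  constructor
  · intro x y hxy
    rw [← ofAlg_toAlg x, ← ofAlg_toAlg y]
    congr 1
    apply hinj
    rw [F.extend_toAlg, F.extend_toAlg, hxy]
  · intro d y hy
    obtain ⟨x, hx, hxy⟩ := hsurj d _ (toAlg_mem hy)
    exact ⟨ofAlg K W x, ofAlg_mem hx, by rw [← F.ofAlg_extend, hxy, ofAlg_toAlg]⟩

/-- A cohomomorphism with bijective linear part is invertible. -/
theorem Cohom.exists_inverse (F : Cohom 𝒲 𝒲')
    (hF : Function.Bijective fun w => pr K W' (F.toLin (word K W 1 fun _ => w))) :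
    ∃ G : Cohom 𝒲' 𝒲, F.toLin ∘ₗ G.toLin = LinearMap.id ∧ G.toLin ∘ₗ F.toLin = LinearMap.id := by
  obtain ⟨hinj, hsurj⟩ := F.bijective_graded hF
  have hbij : Function.Bijective F.toLin := by
    refine ⟨hinj, LinearMap.range_eq_top.1 ?_⟩
    rw [eq_top_iff, ← span_tensorGrading 𝒲']
    refine Submodule.span_le.2 fun y ⟨d, hy⟩ => ?_
    obtain ⟨x, _, hx⟩ := hsurj d y hy
    exact ⟨x, hx⟩
  set e := LinearEquiv.ofBijective F.toLin hbij with he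
  have h1 : F.toLin ∘ₗ e.symm.toLinearMap = LinearMap.id :=
    LinearMap.ext fun y => e.apply_symm_apply y
  have h2 : e.symm.toLinearMap ∘ₗ F.toLin = LinearMap.id :=
    LinearMap.ext fun x => e.symm_apply_apply x
  refine ⟨⟨e.symm.toLinearMap, fun d y hy => ?_, ?_⟩, h1, h2⟩
  · obtain ⟨x, hx, rfl⟩ := hsurj d y hy
    rwa [← LinearMap.comp_apply, h2]
  · have h := F.comul
    -- Compose the identity `Δ F = (F ⊗ F) Δ` with `F⁻¹ ⊗ F⁻¹` on the left and `F⁻¹` on the right.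
    calc coproduct 𝒲 ∘ₗ e.symm.toLinearMap
        = (TensorProduct.map e.symm.toLinearMap e.symm.toLinearMap ∘ₗ
            TensorProduct.map F.toLin F.toLin) ∘ₗ coproduct 𝒲 ∘ₗ e.symm.toLinearMap := by
          rw [← TensorProduct.map_comp, h2, TensorProduct.map_id, LinearMap.id_comp]
      _ = TensorProduct.map e.symm.toLinearMap e.symm.toLinearMap ∘ₗ
            (coproduct 𝒲' ∘ₗ F.toLin) ∘ₗ e.symm.toLinearMap := by
          rw [h]; simp only [LinearMap.comp_assoc]
      _ = _ := by rw [LinearMap.comp_assoc, h1, LinearMap.comp_id]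

end Inverse

/-! ### Sequences of multilinear maps and corestrictions on `T(↓V)` -/

section Desuspension

variable {K : Type*} [Field K] {n : ℕ} {V : Type*} [AddCommGroup V] [Module K V]
  (𝒱 : Deg n → Submodule K V) [DirectSum.Decomposition 𝒱]
  {V' : Type*} [AddCommGroup V'] [Module K V'] (𝒱' : Deg n → Submodule K V')

theorem signOp_signOp (d : Deg n) (v : V) : signOp 𝒱 d (signOp 𝒱 d v) = v := by
  suffices h : signOp 𝒱 d ∘ₗ signOp 𝒱 d = LinearMap.id from LinearMap.congr_fun h v
  refine DirectSum.decompose_lhom_ext 𝒱 fun a => LinearMap.ext fun v => ?_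
  simp [signOp_apply 𝒱 d a v.2, smul_smul, sign_mul_self]

theorem signOp_mem (d : Deg n) {a : Deg n} {v : V} (hv : v ∈ 𝒱 a) : signOp 𝒱 d v ∈ 𝒱 a := by
  rw [signOp_apply 𝒱 d a hv]
  exact Submodule.smul_mem _ _ hv

theorem signOp_zero : signOp 𝒱 (0 : Deg n) = LinearMap.id := by
  refine DirectSum.decompose_lhom_ext 𝒱 fun a => LinearMap.ext fun v => ?_
  simp [signOp_apply 𝒱 0 a v.2, pairing]

variable [NeZero n]

theorem seqOf_apply (Φ : RedTensor K V →ₗ[K] RedTensor K V') (m : ℕ) (v : Fin (m + 1) → V) :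
    seqOf 𝒱 Φ m v = pr K V' (Φ (word K V (m + 1)
      fun s => signOp 𝒱 ((((m + 1 : ℕ) : ℤ) - (s + 1)) • e1 n) (v s))) := rfl

/-- For a single letter the exponent `p - s` is `0`, so no sign appears. -/
theorem unary_seqOf (Φ : RedTensor K V →ₗ[K] RedTensor K V') :
    unary (seqOf 𝒱 Φ 0) = fun v => pr K V' (Φ (word K V 1 fun _ => v)) := by
  funext v
  refine (seqOf_apply 𝒱 Φ 0 _).trans ?_
  simp [signOp_zero]

/-- The corestriction `T(↓V) → ↓V'` corresponding to a sequence of multilinear maps. -/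
def corestriction (f : (m : ℕ) → MultilinearMap K (fun _ : Fin (m + 1) => V) V') :
    RedTensor K V →ₗ[K] V' :=
  DirectSum.toModule K ℕ V' fun m => PiTensorProduct.lift
    ((f m).compLinearMap fun s => signOp 𝒱 ((((m + 1 : ℕ) : ℤ) - (s + 1)) • e1 n))

theorem corestriction_word (f : (m : ℕ) → MultilinearMap K (fun _ : Fin (m + 1) => V) V') (m : ℕ)
    (v : Fin (m + 1) → V) : corestriction 𝒱 f (word K V (m + 1) v) =
      f m fun s => signOp 𝒱 ((((m + 1 : ℕ) : ℤ) - (s + 1)) • e1 n) (v s) := by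
  simp [corestriction, word, incl]

/-- The sign operators are involutions, so the same signs lead from corestrictions to sequences and
back. -/
theorem seqOf_eq_iff (Φ : RedTensor K V →ₗ[K] RedTensor K V')
    (f : (m : ℕ) → MultilinearMap K (fun _ : Fin (m + 1) => V) V') :
    seqOf 𝒱 Φ = f ↔ pr K V' ∘ₗ Φ = corestriction 𝒱 f := by
  constructor
  · rintro rfl
    refine redTensor_ext fun m v => ?_
    rw [corestriction_word, seqOf_apply]
    simp only [signOp_signOp, LinearMap.comp_apply]
  · intro h
    funext m
    ext v
    rw [seqOf_apply, ← LinearMap.comp_apply, h, corestriction_word]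
    simp only [signOp_signOp]

theorem corestriction_mem {f : (m : ℕ) → MultilinearMap K (fun _ : Fin (m + 1) => V) V'}
    (hf : HasCohomWeights 𝒱 𝒱' f) (d : Deg n) (x : RedTensor K V)
    (hx : x ∈ tensorGrading (desusp 𝒱) d) : corestriction 𝒱 f x ∈ desusp 𝒱' d := by
  have h : tensorGrading (desusp 𝒱) d ≤ (desusp 𝒱' d).comap (corestriction 𝒱 f) := by
    refine Submodule.span_le.2 ?_
    rintro _ ⟨p, a, v, hv, rfl, rfl⟩
    cases p with
    | zero => simp [word, incl]
    | succ m =>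
      simp only [Submodule.comap_coe, Set.mem_preimage, corestriction_word]
      have := hf m (fun i => a i + e1 n) _ fun i =>
        signOp_mem 𝒱 ((((m + 1 : ℕ) : ℤ) - (i + 1)) • e1 n) (hv i)
      -- Each of the `m + 1` letters has degree `a i + e₁` in `V`; the weight `-m e₁` leaves one
      -- `e₁`, absorbed by the shift of the target.
      have e : ∑ i, (a i + e1 n) + (1 - (m + 1 : ℤ)) • e1 n = ∑ i, a i + e1 n := by
        rw [Finset.sum_add_distrib, Finset.sum_const, Finset.card_univ, Fintype.card_fin,
          ← natCast_zsmul, add_assoc, ← add_smul]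
        simp
      rwa [e] at this
  exact h hx

end Desuspension

/-! ### Conjugation of coderivations and linear parts of inverses -/

section Transport

open TensorProduct (map)

variable {K : Type*} [Field K] {n : ℕ} {W : Type*} [AddCommGroup W] [Module K W]
  {𝒲 : Deg n → Submodule K W} [DirectSum.Decomposition 𝒲]
  {W' : Type*} [AddCommGroup W'] [Module K W']
  {𝒲' : Deg n → Submodule K W'} [DirectSum.Decomposition 𝒲']

/-- Maps of weight `0` preserve the degrees on which the signs depend. -/
theorem Cohom.comp_tensorSignOp (F : Cohom 𝒲 𝒲') (q : Deg n) :
    F.toLin ∘ₗ tensorSignOp 𝒲 q = tensorSignOp 𝒲' q ∘ₗ F.toLin := by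
  rw [← LinearMap.eqLocus_eq_top, eq_top_iff, ← span_tensorGrading 𝒲]
  refine Submodule.span_le.2 fun x ⟨d, hx⟩ => ?_
  simp [tensorSignOp_apply 𝒲 q d hx, tensorSignOp_apply 𝒲' q d (F.weight d x hx)]

/-- The conjugate of a coderivation by an invertible cohomomorphism is a coderivation. -/
theorem IsCoderivation.conj {q : Deg n} {Q : RedTensor K W →ₗ[K] RedTensor K W}
    (hQ : IsCoderivation 𝒲 q Q) (F : Cohom 𝒲 𝒲') (G : Cohom 𝒲' 𝒲)
    (hFG : F.toLin ∘ₗ G.toLin = LinearMap.id) :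
    IsCoderivation 𝒲' q (F.toLin ∘ₗ Q ∘ₗ G.toLin) where
  weight d x hx := F.weight _ _ (hQ.weight _ _ (G.weight _ _ hx))
  comul := by
    have hS : F.toLin ∘ₗ tensorSignOp 𝒲 q ∘ₗ G.toLin = tensorSignOp 𝒲' q := by
      rw [← LinearMap.comp_assoc, F.comp_tensorSignOp, LinearMap.comp_assoc, hFG,
        LinearMap.comp_id]
    calc coproduct 𝒲' ∘ₗ F.toLin ∘ₗ Q ∘ₗ G.toLin
        = map F.toLin F.toLin ∘ₗ (coproduct 𝒲 ∘ₗ Q) ∘ₗ G.toLin := by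
          rw [← LinearMap.comp_assoc, F.comul]; simp only [LinearMap.comp_assoc]
      _ = map F.toLin F.toLin ∘ₗ (map Q LinearMap.id + map (tensorSignOp 𝒲 q) Q) ∘ₗ
            map G.toLin G.toLin ∘ₗ coproduct 𝒲' := by
          rw [hQ.comul, LinearMap.comp_assoc, G.comul]
      _ = _ := by
          simp only [LinearMap.add_comp, LinearMap.comp_add]
          simp only [← LinearMap.comp_assoc, ← TensorProduct.map_comp]
          simp only [LinearMap.comp_assoc, hS, LinearMap.id_comp, hFG]

/-- The recursion at `x = 1` reads `F(w) = φ(w)`: single letters go to single letters, so linear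
parts compose. -/
theorem Cohom.linear_part (F : Cohom 𝒲 𝒲') (w : W) :
    F.toLin (word K W 1 fun _ => w) =
      word K W' 1 fun _ => pr K W' (F.toLin (word K W 1 fun _ => w)) := by
  suffices h : F.toLin ∘ₗ ofAlg K W ∘ₗ TensorAlgebra.ι K =
      ofAlg K W' ∘ₗ TensorAlgebra.ι K ∘ₗ pr K W' ∘ₗ F.toLin ∘ₗ ofAlg K W ∘ₗ TensorAlgebra.ι K by
    have := LinearMap.congr_fun h w
    simpa only [LinearMap.comp_apply, ofAlg_ι] using this
  refine DirectSum.decompose_lhom_ext 𝒲 fun a => LinearMap.ext fun v => ?_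
  have h := cohomLift_mul_ι 𝒲 (pr K W' ∘ₗ F.toLin ∘ₗ ofAlg K W) v.2 1
  rw [← F.extend_eq, unshuffle_one, one_mul] at h
  simp only [LinearMap.comp_apply, Submodule.subtype_apply]
  rw [← F.ofAlg_extend, h]
  simp [Cohom.extend, ofAlg_ι, pr_word_one]

theorem Cohom.bijective_linear_part_inverse (F : Cohom 𝒲 𝒲') (G : Cohom 𝒲' 𝒲)
    (hGF : G.toLin ∘ₗ F.toLin = LinearMap.id)
    (hF : Function.Bijective fun w => pr K W' (F.toLin (word K W 1 fun _ => w))) :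
    Function.Bijective fun w => pr K W (G.toLin (word K W' 1 fun _ => w)) := by
  refine (Function.Bijective.of_comp_iff _ hF).1 ?_
  convert Function.bijective_id using 1
  funext w
  simp only [Function.comp_apply, id_eq]
  rw [← F.linear_part, show G.toLin (F.toLin _) = _ from LinearMap.congr_fun hGF _]
  exact pr_word_one K W _

end Transport

end LodayInfinity

end

open LodayInfinity in
theorem mainTheorem8 {K : Type*} [Field K] [CharZero K] {n : ℕ} [NeZero n]
    {V : Type*} [AddCommGroup V] [Module K V]
    (𝒱 : Deg n → Submodule K V) [DirectSum.Decomposition 𝒱]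
    {V' : Type*} [AddCommGroup V'] [Module K V']
    (𝒱' : Deg n → Submodule K V') [DirectSum.Decomposition 𝒱'] :
    -- (1) cohomomorphisms with bijective first map are invertible
    (∀ F : Cohom (desusp 𝒱) (desusp 𝒱'),
      Function.Bijective (unary (seqOf 𝒱 F.toLin 0)) →
        ∃ G : Cohom (desusp 𝒱') (desusp 𝒱), AreInverse F G) ∧
    -- (2) transport of structure along a sequence `f` with `f₁ = id`
    (∀ (π : LodInfty 𝒱) (f : (m : ℕ) → MultilinearMap K (fun _ : Fin (m + 1) => V) V),
      HasCohomWeights 𝒱 𝒱 f → unary (f 0) = id →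
        ∃ F : Cohom (desusp 𝒱) (desusp 𝒱),
          seqOf 𝒱 F.toLin = f ∧
          (∀ F' : Cohom (desusp 𝒱) (desusp 𝒱), seqOf 𝒱 F'.toLin = f → F' = F) ∧
          ∃ G : Cohom (desusp 𝒱) (desusp 𝒱), AreInverse F G ∧
            ∃ π' : LodInfty 𝒱, π'.Q = F.toLin ∘ₗ π.Q ∘ₗ G.toLin ∧ IsLodIsomorphism π π' F) ∧
    -- (3) inverses of isomorphisms
    (∀ (π : LodInfty 𝒱) (π' : LodInfty 𝒱') (F : Cohom (desusp 𝒱) (desusp 𝒱')),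
      IsLodIsomorphism π π' F →
        ∃ G : Cohom (desusp 𝒱') (desusp 𝒱), AreInverse F G ∧ IsLodIsomorphism π' π G) := by
  refine ⟨fun F hF => ?_, fun π f hf hf1 => ?_, fun π π' F hF => ?_⟩
  · rw [unary_seqOf] at hF
    exact F.exists_inverse hF
  · set F : Cohom (desusp 𝒱) (desusp 𝒱) :=
      Cohom.ofCorestriction (corestriction 𝒱 f) (corestriction_mem 𝒱 𝒱 hf)
    have hF : pr K V ∘ₗ F.toLin = corestriction 𝒱 f := Cohom.pr_ofCorestriction _ _
    have hseq : seqOf 𝒱 F.toLin = f := (seqOf_eq_iff 𝒱 _ _).2 hF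
    have hbij : Function.Bijective (unary (seqOf 𝒱 F.toLin 0)) := by
      rw [hseq, hf1]
      exact Function.bijective_id
    obtain ⟨G, hFG, hGF⟩ := F.exists_inverse (by rwa [unary_seqOf] at hbij)
    refine ⟨F, hseq, fun F' hF' => Cohom.ext_pr (((seqOf_eq_iff 𝒱 _ _).1 hF').trans hF.symm),
      G, ⟨hFG, hGF⟩, ⟨F.toLin ∘ₗ π.Q ∘ₗ G.toLin, π.isCoderivation.conj F G hFG, ?_⟩, rfl, ?_, hbij⟩
    · calc (F.toLin ∘ₗ π.Q ∘ₗ G.toLin) ∘ₗ F.toLin ∘ₗ π.Q ∘ₗ G.toLin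
          = F.toLin ∘ₗ π.Q ∘ₗ (G.toLin ∘ₗ F.toLin) ∘ₗ π.Q ∘ₗ G.toLin := by
            simp only [LinearMap.comp_assoc]
        _ = F.toLin ∘ₗ (π.Q ∘ₗ π.Q) ∘ₗ G.toLin := by
            rw [hGF, LinearMap.id_comp, LinearMap.comp_assoc]
        _ = 0 := by rw [π.sq_zero, LinearMap.zero_comp, LinearMap.comp_zero]
    · change (F.toLin ∘ₗ π.Q ∘ₗ G.toLin) ∘ₗ F.toLin = F.toLin ∘ₗ π.Q
      rw [LinearMap.comp_assoc, LinearMap.comp_assoc, hGF, LinearMap.comp_id]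
  · obtain ⟨hmor, hbij⟩ := hF
    rw [unary_seqOf] at hbij
    obtain ⟨G, hFG, hGF⟩ := F.exists_inverse hbij
    refine ⟨G, ⟨hFG, hGF⟩, ?_, ?_⟩
    · change π.Q ∘ₗ G.toLin = G.toLin ∘ₗ π'.Q
      have hmor' : π'.Q ∘ₗ F.toLin = F.toLin ∘ₗ π.Q := hmor
      calc π.Q ∘ₗ G.toLin = (G.toLin ∘ₗ F.toLin) ∘ₗ π.Q ∘ₗ G.toLin := by
            rw [hGF, LinearMap.id_comp]
        _ = G.toLin ∘ₗ (F.toLin ∘ₗ π.Q) ∘ₗ G.toLin := by simp only [LinearMap.comp_assoc]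
        _ = G.toLin ∘ₗ π'.Q := by
            rw [← hmor', LinearMap.comp_assoc, hFG, LinearMap.comp_id]
    · rw [unary_seqOf]
      exact F.bijective_linear_part_inverse G hGF hbij
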